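/- For integers $n\ge 0$ let $\int_{n\swarrow n+1}$ and $\int_{n\searrow n+1}$ denote integration over $\mathbb{R}$ along the straight line through $n+\tfrac12$ in the direction $e^{5\pi i/4}$, respectively $e^{-\pi i/4}$. All powers and logarithms are principal. Let $$\mathcal{R}(s)=\int_{0\swarrow 1}\frac{x^{-s}e^{\pi i x^2}}{e^{\pi i x}-e^{-\pi i x}}\,dx$$ be Riemann's auxiliary function, and let $\chi(s)=2^s\pi^{s-1}\sin\bigl(\tfrac{\pi s}{2}\bigr)\Gamma(1-s)$ be the factor in the functional equation $\zeta(s)=\chi(s)\zeta(1-s)$. **Theorem.** Let $s\in\mathbb{C}$ with $0<\arg(s-1)<2\pi$ (that is, $s\notin[1,\infty)$). Let $$\eta:=\sqrt{\frac{s-1}{2\pi i}},\quad -\frac{\pi}{4}<\arg\eta<\frac{3\pi}{4},\quad \eta_1:=\Re\eta,\quad \eta_2:=\Im\eta,\quad m:=\lfloor\eta_1+\eta_2\rfloor,$$ $$w(z):=\exp\Bigl\{2\pi i\eta^2\Bigl(\log\Bigl(1+\frac z\eta\Bigr)-\frac z\eta+\frac12\Bigl(\frac z\eta\Bigr)^2\Bigr)\Bigr\}-1.$$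 Then for each integer $k\ge m$ we have $$\mathcal{R}(s)=\chi(s)\Bigl\{\zeta(1-s)-\sum_{n=1}^{k}n^{s-1}-\eta^{s-1}e^{-\pi i\eta^2}\Bigl[\frac{\sqrt2\,e^{3\pi i/8}\sin\pi\eta-(-1)^k e^{2\pi i\eta-2\pi i(\eta-k)^2}}{2\cos 2\pi\eta}+\sum_{j=m+1}^{k}(-1)^{j-1}e^{-2\pi i(j-\eta)^2}w(j-\eta)+R\Bigr]\Bigr\},$$ where $$R:=\int_{m\searrow m+1}\frac{e^{-2\pi i(x-\eta)^2}}{e^{\pi i x}-e^{-\pi i x}}\,w(x-\eta)\,dx .$$ The integrals defining $\mathcal{R}(s)$ and $R$ converge absolutely. The quotient with denominator $2\cos 2\pi\eta$ has only removable singularities as a function of $\eta$; where $\cos 2\pi\eta=0$ it is replaced by its limit. At $s=0$, where $\zeta(1-s)$ has a pole and $\chi$ a zero, the formula is read as a limit: $\chi(z)\{\zeta(1-z)-\dots\}\to\mathcal{R}(0)$ as $z\to0$, $z\ne 0$, where "$\dots$" stands for the remaining terms, evaluated at $s=0$. -/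

import Mathlib

open Complex Filter MeasureTheory
open scoped Topology

noncomputable section

/-- The integrand of the complex line integral of `f` along `u ↦ a + u d`, `u` running over `ℝ`. -/
def lineIntegrand (f : ℂ → ℂ) (a d : ℂ) (u : ℝ) : ℂ :=
  f (a + (u : ℂ) * d) * d

/-- The integral of `f` along the straight line through `a` with direction `d`,
run through in the direction `d`. -/
def lineIntegral (f : ℂ → ℂ) (a d : ℂ) : ℂ :=
  ∫ u : ℝ, lineIntegrand f a d u

/-- The direction of a path `n ↙ n+1`: from the upper right to the lower left. -/
def dirSW : ℂ := exp (5 * Real.pi * Complex.I / 4)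

/-- The direction of a path `n ↘ n+1`: from the upper left to the lower right. -/
def dirSE : ℂ := exp (-(Real.pi * Complex.I / 4))

/-- The integrand `x^{-s} e^{π i x²} / (e^{π i x} - e^{-π i x})`, principal branch of `x^{-s}`. -/
def auxIntegrand (s x : ℂ) : ℂ :=
  x ^ (-s) * exp (Real.pi * Complex.I * x ^ 2) / (exp (Real.pi * Complex.I * x) - exp (-(Real.pi * Complex.I * x)))

/-- Riemann's auxiliary function, the integral of `auxIntegrand s` along `0 ↙ 1`. -/
def riemannAux (s : ℂ) : ℂ :=
  lineIntegral (auxIntegrand s) (1 / 2) dirSW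

/-- The factor `χ(s)` of the functional equation `ζ(s) = χ(s) ζ(1-s)`. -/
def chiFactor (s : ℂ) : ℂ :=
  2 ^ s * (Real.pi : ℂ) ^ (s - 1) * sin (Real.pi * s / 2) * Gamma (1 - s)

/-- `w(z) = exp{2π i η² (log(1 + z/η) - z/η + (z/η)²/2)} - 1`, principal logarithm. -/
def wFun (η z : ℂ) : ℂ :=
  exp (2 * Real.pi * Complex.I * η ^ 2 * (log (1 + z / η) - z / η + 1 / 2 * (z / η) ^ 2)) - 1

/-- The quotient
`(√2 e^{3π i/8} sin πη - (-1)^k e^{2π i η - 2π i (η-k)²}) / (2 cos 2πη)`. -/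
def riemannQuot (k : ℤ) (η : ℂ) : ℂ :=
  ((Real.sqrt 2 : ℂ) * exp (3 * Real.pi * Complex.I / 8) * sin (Real.pi * η)
      - (-1) ^ k * exp (2 * Real.pi * Complex.I * η - 2 * Real.pi * Complex.I * (η - k) ^ 2))
    / (2 * cos (2 * Real.pi * η))

/-- `riemannQuot k` with its removable singularities (the zeros of `cos 2πη`) removed. -/
def riemannTerm (k : ℤ) (η : ℂ) : ℂ :=
  limUnder (𝓝[≠] η) (riemannQuot k)

/-- Away from the zeros of the denominator, `riemannTerm` is the quotient itself. -/
theorem riemannTerm_eq_quot (k : ℤ) (η : ℂ) (h : cos (2 * Real.pi * η) ≠ 0) :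
    riemannTerm k η = riemannQuot k η := by
  have hc : ContinuousAt (riemannQuot k) η := by
    unfold riemannQuot
    refine ContinuousAt.div (by fun_prop) (by fun_prop) ?_
    exact mul_ne_zero two_ne_zero h
  exact (hc.tendsto.mono_left nhdsWithin_le_nhds).limUnder_eq

/-- The integrand `e^{-2π i (x-η)²} w(x-η) / (e^{π i x} - e^{-π i x})` of the remainder. -/
def remIntegrand (η x : ℂ) : ℂ :=
  exp (-(2 * Real.pi * Complex.I * (x - η) ^ 2))
    / (exp (Real.pi * Complex.I * x) - exp (-(Real.pi * Complex.I * x))) * wFun η (x - η)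

/-- The remainder `R`, the integral of `remIntegrand η` along `m ↘ m+1`. -/
def remainderR (η : ℂ) (m : ℤ) : ℂ :=
  lineIntegral (remIntegrand η) (m + 1 / 2) dirSE

/-- `∑_{n=1}^k n^{s-1} + η^{s-1} e^{-π i η²} [riemannTerm k η +
∑_{j=m+1}^k (-1)^{j-1} e^{-2π i (j-η)²} w(j-η) + R ]`, the part of the formula that is
subtracted from `ζ(1-s)`. -/
def siegelPart (s η : ℂ) (m k : ℤ) : ℂ :=
  ∑ n ∈ Finset.Icc 1 k, (n : ℂ) ^ (s - 1)
    + η ^ (s - 1) * exp (-(Real.pi * Complex.I * η ^ 2)) *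
      (riemannTerm k η
        + ∑ j ∈ Finset.Icc (m + 1) k,
            (-1) ^ (j - 1) * exp (-(2 * Real.pi * Complex.I * ((j : ℂ) - η) ^ 2)) * wFun η ((j : ℂ) - η)
        + remainderR η m)

end

/-!
For `Re s < -1` the path of `riemannAux s` can be pushed to the origin, which turns the integral
into a Mellin transform of `e^{π i x²} / (e^{π i x} - e^{-π i x})` along a ray. Riemann's
evaluation of the Mordell integral writes this quotient as a superposition of exponentials minus
`1 / (e^{-2π i x} - 1)`; transforming both parts gives `ℛ(s) = χ(s) (ζ(1-s) - 𝒟(s))`, where `𝒟`,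
the function `dualAux`, is an entire integral along `0 ↘ 1`. The identity theorem extends this to
all `s ∉ [1, ∞)`.

Moving the path of `𝒟(s)` across the poles `1, …, k` produces `∑ n^{s-1}`. The remaining integrand
has a saddle point at `η`, around which it is a constant times the Gaussian `e^{-2π i (x-η)²}`
times `1 + w(x-η)`. The Gaussian part is again a Mordell integral. Both translations `p ↦ p + 1`
(the denominator cancels) and `p ↦ p + α` (a residue) act on it explicitly, and where the two are
commensurable, as for `α = 1` and `α = 2`, they determine it; for `α = 2` the outcome is the
quotient with denominator `2 cos 2πη`. The part with `w`, moved back to `m ↘ m+1`, is `R`.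
-/

noncomputable section

open Bornology

/-! ### Parallel strips and contour shifts -/

/-- The closed strip between the parallels of direction `d` through `a` and through `b`, the second
one lying to the left of the first; `strip d a a` is the line itself. -/
def strip (d a b : ℂ) : Set ℂ := (fun x => (x / d).im) ⁻¹' Set.Icc (a / d).im (b / d).im

/-- The open strip between the parallels of direction `d` through `a` and through `b`. -/
def openStrip (d a b : ℂ) : Set ℂ := (fun x => (x / d).im) ⁻¹' Set.Ioo (a / d).im (b / d).im

theorem openStrip_subset_strip (d a b : ℂ) : openStrip d a b ⊆ strip d a b :=
  Set.preimage_mono Set.Ioo_subset_Icc_self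

theorem isOpen_openStrip (d a b : ℂ) : IsOpen (openStrip d a b) :=
  isOpen_Ioo.preimage (by fun_prop)

theorem add_ofReal_mul_mem_strip (a d : ℂ) (u : ℝ) : a + u * d ∈ strip d a a := by
  rcases eq_or_ne d 0 with rfl | hd <;> simp [strip, add_div, *]

theorem strip_subset_strip {d a b a' b' : ℂ} (ha : a ∈ strip d a' b') (hb : b ∈ strip d a' b') :
    strip d a b ⊆ strip d a' b' :=
  fun _ hx => ⟨ha.1.trans hx.1, hx.2.trans hb.2⟩

/-- `φ` decays faster than every exponential `e^{-B‖x‖}` as `x → ∞` within `S`. -/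
def SuperexpDecayOn (φ : ℂ → ℂ) (S : Set ℂ) : Prop :=
  ∀ B : ℝ, φ =O[cobounded ℂ ⊓ 𝓟 S] fun x => Real.exp (-B * ‖x‖)

/-- `φ` grows at most exponentially as `x → ∞` within `S`. -/
def ExpGrowthOn (φ : ℂ → ℂ) (S : Set ℂ) : Prop :=
  ∃ A : ℝ, φ =O[cobounded ℂ ⊓ 𝓟 S] fun x => Real.exp (A * ‖x‖)

namespace SuperexpDecayOn

variable {φ ψ : ℂ → ℂ} {S T : Set ℂ}

theorem mono (h : SuperexpDecayOn φ S) (hT : T ⊆ S) : SuperexpDecayOn φ T :=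
  fun B => (h B).mono (inf_le_inf_left _ (principal_mono.2 hT))

theorem sub (h : SuperexpDecayOn φ S) (h' : SuperexpDecayOn ψ S) :
    SuperexpDecayOn (fun x => φ x - ψ x) S :=
  fun B => (h B).sub (h' B)

theorem mul (h : SuperexpDecayOn φ S) (h' : ExpGrowthOn ψ S) :
    SuperexpDecayOn (fun x => ψ x * φ x) S := by
  obtain ⟨A, hA⟩ := h'
  refine fun B => (hA.mul (h (A + B))).congr_right fun x => ?_
  rw [← Real.exp_add]
  ring_nf

theorem comp_add_const (h : SuperexpDecayOn φ S) (c : ℂ) :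
    SuperexpDecayOn (fun x => φ (x + c)) ((· + c) ⁻¹' S) := by
  intro B
  have hc : Tendsto (· + c) (cobounded ℂ ⊓ 𝓟 ((· + c) ⁻¹' S)) (cobounded ℂ ⊓ 𝓟 S) :=
    (tendsto_add_const_cobounded c).inf (tendsto_principal_principal.2 fun _ hx => hx)
  refine ((h |B|).comp_tendsto hc).trans (.of_bound (Real.exp (|B| * ‖c‖)) (.of_forall fun x => ?_))
  have hnorm : ‖x‖ ≤ ‖x + c‖ + ‖c‖ := by simpa using norm_sub_le (x + c) c
  simp only [Function.comp_apply, Real.norm_eq_abs, Real.abs_exp, ← Real.exp_add]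
  gcongr
  nlinarith [le_abs_self B, abs_nonneg B, norm_nonneg x]

theorem tendsto_zero (h : SuperexpDecayOn φ S) : Tendsto φ (cobounded ℂ ⊓ 𝓟 S) (𝓝 0) :=
  (h 1).trans_tendsto (Real.tendsto_exp_atBot.comp
    (((tendsto_norm_cobounded_atTop (E := ℂ)).mono_left inf_le_left).const_mul_atTop_of_neg
      (by norm_num)))

theorem congr (h : SuperexpDecayOn φ S) (hφ : φ =ᶠ[cobounded ℂ] ψ) : SuperexpDecayOn ψ S :=
  fun B => (h B).congr' (hφ.filter_mono inf_le_left) .rfl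

end SuperexpDecayOn

theorem tendsto_add_ofReal_mul_cobounded {d : ℂ} (hd : d ≠ 0) (a : ℂ) :
    Tendsto (fun u : ℝ => a + u * d) (cobounded ℝ) (cobounded ℂ ⊓ 𝓟 (strip d a a)) := by
  refine tendsto_inf.2 ⟨?_, tendsto_principal.2 (.of_forall (add_ofReal_mul_mem_strip a d))⟩
  refine (tendsto_const_add_cobounded a).comp (tendsto_norm_atTop_iff_cobounded.1 ?_)
  simpa using (tendsto_norm_cobounded_atTop (E := ℝ)).atTop_mul_const (norm_pos_iff.2 hd)

theorem exists_abs_le_norm_add_ofReal_mul {d : ℂ} (hd : d ≠ 0) (a : ℂ) :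
    ∃ C : ℝ, ∀ u : ℝ, |u| ≤ ‖d‖⁻¹ * ‖a + u * d‖ + C := by
  refine ⟨‖d‖⁻¹ * ‖a‖, fun u => ?_⟩
  have h : ‖(u : ℂ) * d‖ ≤ ‖a + u * d‖ + ‖a‖ := by simpa using norm_sub_le (a + u * d) a
  rw [norm_mul, norm_real, Real.norm_eq_abs] at h
  have := norm_pos_iff.2 hd
  rw [← mul_add, inv_mul_eq_div, le_div_iff₀ this]
  exact h

theorem SuperexpDecayOn.integrable_lineIntegrand {f : ℂ → ℂ} {a d : ℂ} (hd : d ≠ 0)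
    (hc : ContinuousOn f (strip d a a)) (hf : SuperexpDecayOn f (strip d a a)) :
    Integrable (lineIntegrand f a d) := by
  have hcont : Continuous fun u : ℝ => f (a + u * d) :=
    hc.comp_continuous (by fun_prop) (add_ofReal_mul_mem_strip a d)
  obtain ⟨C, hC⟩ := exists_abs_le_norm_add_ofReal_mul hd a
  have hexp : (fun u : ℝ => Real.exp (-(2 * ‖d‖⁻¹) * ‖a + u * d‖)) =O[cocompact ℝ]
      fun u => (1 + u ^ 2)⁻¹ := by
    refine .of_bound (Real.exp (2 * C)) (.of_forall fun u => ?_)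
    have hquad : 1 + u ^ 2 ≤ Real.exp (2 * |u|) := by
      have := Real.quadratic_le_exp_of_nonneg (x := 2 * |u|) (by positivity)
      nlinarith [abs_nonneg u, sq_abs u]
    rw [Real.norm_of_nonneg (by positivity), Real.norm_of_nonneg (by positivity), le_mul_inv_iff₀
      (by positivity)]
    calc Real.exp (-(2 * ‖d‖⁻¹) * ‖a + u * d‖) * (1 + u ^ 2)
        ≤ Real.exp (-(2 * ‖d‖⁻¹) * ‖a + u * d‖) * Real.exp (2 * |u|) := by gcongr
      _ ≤ Real.exp (2 * C) := by
        rw [← Real.exp_add]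
        gcongr
        linarith [hC u]
  have hlim := tendsto_add_ofReal_mul_cobounded hd a
  rw [Metric.cobounded_eq_cocompact] at hlim
  exact (hcont.locallyIntegrable.integrable_of_isBigO_cocompact
    (((hf (2 * ‖d‖⁻¹)).comp_tendsto hlim).trans hexp)
    (integrable_inv_one_add_sq.integrableAtFilter _)).mul_const d

theorem tendsto_intervalIntegral_vertical {g : ℂ → ℂ} {a b : ℝ} (hab : a ≤ b)
    (hg : Tendsto g (cobounded ℂ ⊓ 𝓟 (im ⁻¹' Set.Icc a b)) (𝓝 0)) :
    Tendsto (fun T : ℝ => ∫ y in a..b, g (T + y * I)) (cobounded ℝ) (𝓝 0) := by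
  rw [Metric.tendsto_nhds]
  intro ε hε
  have hδ : 0 < ε / (b - a + 1) := div_pos hε (by linarith)
  obtain ⟨R, -, hR⟩ := (hasBasis_cobounded_norm.inf_principal _).eventually_iff.1
    (Metric.tendsto_nhds.1 hg _ hδ)
  filter_upwards [eventually_cobounded_le_norm R] with T hT
  have hbound : ∀ y ∈ Set.uIoc a b, ‖g (T + y * I)‖ ≤ ε / (b - a + 1) := by
    intro y hy
    rw [Set.uIoc_of_le hab] at hy
    have hre : |T| ≤ ‖(T + y * I : ℂ)‖ := by simpa using abs_re_le_norm (T + y * I)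
    simpa using (hR (x := T + y * I) ⟨hT.trans hre, by simpa using ⟨hy.1.le, hy.2⟩⟩).le
  rw [dist_zero_right]
  refine (intervalIntegral.norm_integral_le_of_norm_le_const hbound).trans_lt ?_
  rw [abs_of_nonneg (sub_nonneg.2 hab), div_mul_eq_mul_div, div_lt_iff₀ (by linarith)]
  nlinarith

theorem integral_horizontal_eq {g : ℂ → ℂ} {a b : ℝ} (hab : a ≤ b)
    (hc : ContinuousOn g (im ⁻¹' Set.Icc a b)) (hd : DifferentiableOn ℂ g (im ⁻¹' Set.Ioo a b))
    (hg : Tendsto g (cobounded ℂ ⊓ 𝓟 (im ⁻¹' Set.Icc a b)) (𝓝 0))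
    (hia : Integrable fun u : ℝ => g (u + a * I)) (hib : Integrable fun u : ℝ => g (u + b * I)) :
    ∫ u : ℝ, g (u + a * I) = ∫ u : ℝ, g (u + b * I) := by
  have rectangle (T : ℝ) : (∫ u in (-T)..T, g (u + a * I)) - (∫ u in (-T)..T, g (u + b * I))
      + I • (∫ y in a..b, g (T + y * I)) - I • (∫ y in a..b, g ((-T : ℝ) + y * I)) = 0 := by
    have := integral_boundary_rect_eq_zero_of_continuousOn_of_differentiableOn g
      (-T + a * I) (T + b * I) (hc.mono fun z hz => by simpa [Set.uIcc_of_le hab] using hz.2)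
      (hd.mono fun z hz => by simpa [hab] using hz.2)
    simpa using this
  have hvert := (tendsto_intervalIntegral_vertical hab hg).const_smul I
  rw [IsOrderBornology.cobounded_eq, smul_zero, tendsto_sup] at hvert
  have hlim := (((intervalIntegral_tendsto_integral hia tendsto_neg_atTop_atBot tendsto_id).sub
    (intervalIntegral_tendsto_integral hib tendsto_neg_atTop_atBot tendsto_id)).add hvert.2).sub
      (hvert.1.comp tendsto_neg_atTop_atBot)
  simpa [sub_eq_zero] using tendsto_nhds_unique (hlim.congr rectangle) tendsto_const_nhds

theorem lineIntegrand_eq_horizontal {d : ℂ} (hd : d ≠ 0) (f : ℂ → ℂ) (a : ℂ) (u : ℝ) :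
    lineIntegrand f a d u = f (((u + (a / d).re : ℝ) + (a / d).im * I) * d) * d := by
  rw [lineIntegrand, ofReal_add, add_assoc, re_add_im, add_mul, div_mul_cancel₀ a hd, add_comm a]

theorem SuperexpDecayOn.lineIntegral_eq {f : ℂ → ℂ} {a b d : ℂ} (hd : d ≠ 0)
    (hab : (a / d).im ≤ (b / d).im) (hc : ContinuousOn f (strip d a b))
    (hf : DifferentiableOn ℂ f (openStrip d a b)) (hdec : SuperexpDecayOn f (strip d a b)) :
    lineIntegral f a d = lineIntegral f b d := by
  have hline {c : ℂ} (hmem : c ∈ strip d a b) :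
      Integrable (fun u : ℝ => f ((u + (c / d).im * I) * d) * d) ∧
        lineIntegral f c d = ∫ u : ℝ, f ((u + (c / d).im * I) * d) * d := by
    have hsub := strip_subset_strip hmem hmem
    have hint := (hdec.mono hsub).integrable_lineIntegrand hd (hc.mono hsub)
    simp only [lineIntegral, funext (lineIntegrand_eq_horizontal hd f c)] at hint ⊢
    have h := integral_add_right_eq_self (μ := volume)
      (fun u : ℝ => f ((u + (c / d).im * I) * d) * d) (c / d).re
    exact ⟨by simpa using hint.comp_sub_right (c / d).re, h⟩
  obtain ⟨hia, ha⟩ := hline ⟨le_rfl, hab⟩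
  obtain ⟨hib, hb⟩ := hline ⟨hab, le_rfl⟩
  have hmul {s : Set ℝ} : Set.MapsTo (· * d) (im ⁻¹' s) ((fun x => (x / d).im) ⁻¹' s) :=
    fun z hz => by simpa [hd] using hz
  rw [ha, hb]
  refine integral_horizontal_eq (g := fun z => f (z * d) * d) hab
    ((hc.comp (by fun_prop) hmul).mul continuousOn_const)
    ((hf.comp (by fun_prop) hmul).mul_const d) ?_ hia hib
  have hscale : Tendsto (· * d) (cobounded ℂ) (cobounded ℂ) := by
    refine tendsto_norm_atTop_iff_cobounded.1 ?_
    simpa using (tendsto_norm_cobounded_atTop (E := ℂ)).atTop_mul_const (norm_pos_iff.2 hd)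
  simpa using (hdec.tendsto_zero.comp (hscale.inf (tendsto_principal_principal.2 hmul))).mul_const d

theorem exists_abs_div_im_le_of_mem_strip (d a b : ℂ) :
    ∃ M : ℝ, ∀ x ∈ strip d a b, |(x / d).im| ≤ M :=
  ⟨_, fun _ hx => abs_le_max_abs_abs hx.1 hx.2⟩

theorem tendsto_abs_im_strip {d : ℂ} (hd : d.im ≠ 0) (a b : ℂ) :
    Tendsto (fun x => |x.im|) (cobounded ℂ ⊓ 𝓟 (strip d a b)) atTop := by
  have hd0 : d ≠ 0 := by rintro rfl; simp at hd
  obtain ⟨M, hM⟩ := exists_abs_div_im_le_of_mem_strip d a b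
  have hlim : Tendsto (fun x : ℂ => |d.im| * (‖x‖ / ‖d‖) + -((|d.re| + |d.im|) * M))
      (cobounded ℂ ⊓ 𝓟 (strip d a b)) atTop :=
    tendsto_atTop_add_const_right _ _ (((tendsto_norm_cobounded_atTop.mono_left
      inf_le_left).atTop_div_const (norm_pos_iff.2 hd0)).const_mul_atTop (abs_pos.2 hd))
  refine tendsto_atTop_mono' _ ?_ hlim
  filter_upwards [mem_inf_of_right (mem_principal_self _)] with x hx
  set z := x / d with hz
  have him : x.im = d.re * z.im + d.im * z.re := by
    rw [← mul_im, hz, mul_div_cancel₀ x hd0]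
  have hre : |d.im| * |z.re| ≤ |x.im| + |d.re| * |z.im| := by
    rw [← abs_mul, ← abs_mul, show d.im * z.re = x.im - d.re * z.im by rw [him]; ring]
    exact abs_sub _ _
  have hnorm : ‖x‖ / ‖d‖ ≤ |z.re| + |z.im| := by
    rw [← norm_div]; exact norm_le_abs_re_add_abs_im z
  nlinarith [hM x hx, abs_nonneg d.re, abs_nonneg d.im,
    mul_le_mul_of_nonneg_left hnorm (abs_nonneg d.im)]

theorem superexpDecayOn_gaussian {α : ℝ} (hα : 0 < α) {d : ℂ} (hd : d ≠ 0) (a b : ℂ) :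
    SuperexpDecayOn (fun x => exp (-α * (x / d) ^ 2)) (strip d a b) := by
  intro B
  obtain ⟨M, hM⟩ := exists_abs_div_im_le_of_mem_strip d a b
  refine .of_bound (Real.exp (2 * α * M ^ 2 + B ^ 2 * ‖d‖ ^ 2 / (4 * α))) ?_
  filter_upwards [mem_inf_of_right (mem_principal_self _)] with x hx
  have hre : (-α * (x / d) ^ 2).re = -(α * (‖x‖ ^ 2 / ‖d‖ ^ 2)) + 2 * α * (x / d).im ^ 2 := by
    rw [← div_pow, ← norm_div, ← normSq_eq_norm_sq, normSq_apply, sq, ← ofReal_neg, re_ofReal_mul,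
      mul_re]
    ring
  have him : (x / d).im ^ 2 ≤ M ^ 2 := sq_le_sq.2 ((hM x hx).trans (le_abs_self M))
  have : 0 < ‖d‖ := norm_pos_iff.2 hd
  have hquad : B * ‖x‖ ≤ α * (‖x‖ ^ 2 / ‖d‖ ^ 2) + B ^ 2 * ‖d‖ ^ 2 / (4 * α) := by
    rw [← sub_nonneg]
    calc (0 : ℝ) ≤ α * (‖x‖ / ‖d‖ - B * ‖d‖ / (2 * α)) ^ 2 := by positivity
      _ = _ := by field_simp; ring
  rw [norm_exp, hre, Real.norm_of_nonneg (Real.exp_pos _).le, ← Real.exp_add]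
  exact Real.exp_le_exp.2 (by nlinarith)

theorem expGrowthOn_const (c : ℂ) (S : Set ℂ) : ExpGrowthOn (fun _ => c) S :=
  ⟨0, by simpa using Asymptotics.isBigO_const_const c (one_ne_zero (α := ℝ)) _⟩

theorem expGrowthOn_exp_mul (c : ℂ) (S : Set ℂ) : ExpGrowthOn (fun x => exp (c * x)) S := by
  refine ⟨‖c‖, .of_bound 1 (.of_forall fun x => ?_)⟩
  rw [one_mul, Real.norm_of_nonneg (Real.exp_pos _).le, ← norm_mul]
  exact norm_exp_le_exp_norm _

theorem expGrowthOn_cpow_const (w : ℂ) (S : Set ℂ) : ExpGrowthOn (fun x => x ^ w) S := by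
  have hne : ∀ᶠ x : ℂ in cobounded ℂ ⊓ 𝓟 S, id x ≠ 0 :=
    ((tendsto_norm_cobounded_atTop.eventually_gt_atTop 0).mono
      fun _ => norm_pos_iff.1).filter_mono inf_le_left
  refine ⟨1, (isTheta_cpow_const_rpow (f := id) (b := w) fun _ _ => hne).isBigO.trans ?_⟩
  simpa [Function.comp_def] using ((isLittleO_rpow_exp_atTop w.re).isBigO.comp_tendsto
    ((tendsto_norm_cobounded_atTop (E := ℂ)).mono_left inf_le_left))

/-! ### Integrals depending holomorphically on a parameter -/

theorem differentiableAt_integral_exp_mul {X : Type*} [MeasurableSpace X] {μ : Measure X}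
    {L h : X → ℂ} {z : ℂ} {δ : ℝ} (hδ : 0 < δ) (hL : AEStronglyMeasurable L μ)
    (hh : AEStronglyMeasurable h μ)
    (hint : Integrable (fun x => Real.exp (δ * ‖L x‖) * ‖exp (z * L x) * h x‖) μ) :
    DifferentiableAt ℂ (fun z => ∫ x, exp (z * L x) * h x ∂μ) z := by
  have hmeas (w : ℂ) : AEStronglyMeasurable (fun x => exp (w * L x) * h x) μ :=
    (continuous_exp.comp_aestronglyMeasurable (hL.const_mul w)).mul hh
  have hbase : Integrable (fun x => exp (z * L x) * h x) μ :=
    hint.mono (hmeas z) (.of_forall fun x => by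
      rw [norm_mul (Real.exp _), norm_norm, Real.norm_of_nonneg (Real.exp_pos _).le]
      exact le_mul_of_one_le_left (norm_nonneg _) (Real.one_le_exp (by positivity)))
  have hbound : ∀ x, ∀ w ∈ Metric.ball z (δ / 2), ‖L x * exp (w * L x) * h x‖ ≤
      2 / δ * (Real.exp (δ * ‖L x‖) * ‖exp (z * L x) * h x‖) := by
    intro x w hw
    have hsplit : L x * exp (w * L x) * h x =
        L x * exp ((w - z) * L x) * (exp (z * L x) * h x) := by
      rw [show w * L x = (w - z) * L x + z * L x by ring, Complex.exp_add]; ring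
    have hlinear : ‖L x‖ ≤ 2 / δ * Real.exp (δ / 2 * ‖L x‖) := by
      rw [div_mul_eq_mul_div, le_div_iff₀ hδ]
      linarith [Real.add_one_le_exp (δ / 2 * ‖L x‖)]
    have hexp : ‖exp ((w - z) * L x)‖ ≤ Real.exp (δ / 2 * ‖L x‖) := by
      refine (norm_exp_le_exp_norm _).trans (Real.exp_le_exp.2 ?_)
      rw [norm_mul]
      gcongr
      exact (mem_ball_iff_norm.1 hw).le
    calc ‖L x * exp (w * L x) * h x‖
        = ‖L x‖ * ‖exp ((w - z) * L x)‖ * ‖exp (z * L x) * h x‖ := by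
          rw [hsplit, norm_mul, norm_mul (L x)]
      _ ≤ 2 / δ * Real.exp (δ / 2 * ‖L x‖) * Real.exp (δ / 2 * ‖L x‖) *
            ‖exp (z * L x) * h x‖ := by gcongr
      _ = _ := by rw [mul_assoc (2 / δ), ← Real.exp_add, ← add_mul, add_halves, mul_assoc]
  refine (hasDerivAt_integral_of_dominated_loc_of_deriv_le (F := fun w x => exp (w * L x) * h x)
    (F' := fun w x => L x * exp (w * L x) * h x) (Metric.ball_mem_nhds z (half_pos hδ))
    (.of_forall hmeas) hbase ?_ (.of_forall hbound) (hint.const_mul _)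
    (.of_forall fun x w _ => ?_)).2.differentiableAt
  · simpa only [mul_assoc] using! hL.mul (hmeas z)
  · simpa only [one_mul, mul_comm (L x)] using
      (((hasDerivAt_id' w).mul_const (L x)).cexp).mul_const (h x)

theorem SuperexpDecayOn.differentiable_lineIntegral {f ℓ : ℂ → ℂ} {a d : ℂ} (hd : d ≠ 0)
    (hdec : SuperexpDecayOn f (strip d a a)) (hf : ContinuousOn f (strip d a a))
    (hℓ : ContinuousOn ℓ (strip d a a)) (hlin : ℓ =O[cobounded ℂ ⊓ 𝓟 (strip d a a)] id) :
    Differentiable ℂ fun z => lineIntegral (fun x => exp (z * ℓ x) * f x) a d := by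
  intro z
  have hpath {g : ℂ → ℂ} (hg : ContinuousOn g (strip d a a)) :
      Continuous fun u : ℝ => g (a + u * d) :=
    hg.comp_continuous (by fun_prop) (add_ofReal_mul_mem_strip a d)
  have hgrowth : ExpGrowthOn (fun x => exp ((1 + ‖z‖) * ‖ℓ x‖ : ℝ)) (strip d a a) := by
    obtain ⟨A, hA⟩ := hlin.bound
    refine ⟨(1 + ‖z‖) * A, .of_bound 1 ?_⟩
    filter_upwards [hA] with x hx
    rw [norm_exp, ofReal_re, one_mul, Real.norm_of_nonneg (Real.exp_pos _).le, mul_assoc]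
    gcongr
    exact hx
  have hmajorant := (hdec.mul hgrowth).integrable_lineIntegrand hd (by fun_prop)
  have hcont : Continuous fun u : ℝ => Real.exp (1 * ‖ℓ (a + u * d)‖) *
      ‖exp (z * ℓ (a + u * d)) * (f (a + u * d) * d)‖ :=
    (by fun_prop : Continuous fun p : ℂ × ℂ => Real.exp (1 * ‖p.1‖) *
      ‖exp (z * p.1) * (p.2 * d)‖).comp ((hpath hℓ).prodMk (hpath hf))
  have h := differentiableAt_integral_exp_mul (μ := volume) (z := z) one_pos
    (hpath hℓ).aestronglyMeasurable ((hpath hf).mul continuous_const).aestronglyMeasurable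
    (hmajorant.mono hcont.aestronglyMeasurable (.of_forall fun u => ?_))
    (h := fun u : ℝ => f (a + u * d) * d)
  · simpa only [lineIntegral, lineIntegrand, mul_assoc] using h
  · have hexp := norm_exp_le_exp_norm (z * ℓ (a + u * d))
    rw [lineIntegrand, norm_mul, norm_norm, norm_mul, Real.norm_of_nonneg (Real.exp_pos _).le,
      norm_mul _ d, norm_mul _ d, norm_mul, norm_exp ((_ : ℝ) : ℂ), ofReal_re, add_mul,
      Real.exp_add, ← norm_mul z, mul_assoc, mul_assoc]
    gcongr

/-! ### The directions of the paths and the denominator -/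

theorem dirSE_eq : dirSE = (Real.sqrt 2 / 2 : ℝ) * (1 - I) := by
  rw [dirSE, show -(Real.pi * I / 4 : ℂ) = (-(Real.pi / 4) : ℝ) * I by push_cast; ring,
    exp_mul_I, ← ofReal_cos, ← ofReal_sin, Real.cos_neg, Real.sin_neg, Real.cos_pi_div_four,
    Real.sin_pi_div_four]
  push_cast; ring

theorem dirSE_ne_zero : dirSE ≠ 0 := exp_ne_zero _

theorem dirSW_ne_zero : dirSW ≠ 0 := exp_ne_zero _

theorem dirSW_eq_neg_I_mul_dirSE : dirSW = -(I * dirSE) := by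
  have : I = exp (Real.pi / 2 * I) := exp_pi_div_two_mul_I.symm
  nth_rw 1 [this]
  rw [dirSE, dirSW, ← Complex.exp_add, ← neg_one_mul, ← exp_pi_mul_I, ← Complex.exp_add]
  ring_nf

theorem dirSE_sq : dirSE ^ 2 = -I := by
  rw [dirSE, ← Complex.exp_nat_mul, ← Complex.exp_neg_pi_div_two_mul_I]
  push_cast
  ring_nf

theorem dirSW_sq : dirSW ^ 2 = I := by
  rw [dirSW_eq_neg_I_mul_dirSE, neg_sq, mul_pow, I_sq, dirSE_sq]; ring

theorem dirSE_re : dirSE.re = Real.sqrt 2 / 2 := by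
  simp [dirSE_eq]

theorem dirSE_im : dirSE.im = -(Real.sqrt 2 / 2) := by
  simp [dirSE_eq]

theorem dirSE_im_ne_zero : dirSE.im ≠ 0 := by
  simp [dirSE_im]

theorem dirSW_im_ne_zero : dirSW.im ≠ 0 := by
  simp [dirSW_eq_neg_I_mul_dirSE, dirSE_re]

theorem div_dirSE_im (x : ℂ) : (x / dirSE).im = Real.sqrt 2 / 2 * (x.re + x.im) := by
  have hinv : x / dirSE = x * (I * dirSE) := by
    rw [div_eq_iff dirSE_ne_zero]; linear_combination (-x * I) * dirSE_sq + x * I_sq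
  rw [hinv, mul_im, I_mul_im, I_mul_re, dirSE_re, dirSE_im]
  ring

theorem div_dirSW_im (x : ℂ) : (x / dirSW).im = Real.sqrt 2 / 2 * (x.re - x.im) := by
  have hI : x / dirSW = x * I / dirSE := by
    rw [dirSW_eq_neg_I_mul_dirSE, div_eq_div_iff
      (neg_ne_zero.2 (mul_ne_zero I_ne_zero dirSE_ne_zero)) dirSE_ne_zero]
    linear_combination x * dirSE * I_sq
  rw [hI, div_dirSE_im]
  simp [sub_eq_neg_add]

theorem mem_strip_dirSE_iff {a b x : ℂ} :
    x ∈ strip dirSE a b ↔ a.re + a.im ≤ x.re + x.im ∧ x.re + x.im ≤ b.re + b.im := by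
  simp [strip, div_dirSE_im]

theorem mem_openStrip_dirSE_iff {a b x : ℂ} :
    x ∈ openStrip dirSE a b ↔ a.re + a.im < x.re + x.im ∧ x.re + x.im < b.re + b.im := by
  simp [openStrip, div_dirSE_im]

theorem mem_strip_dirSW_iff {a b x : ℂ} :
    x ∈ strip dirSW a b ↔ a.re - a.im ≤ x.re - x.im ∧ x.re - x.im ≤ b.re - b.im := by
  simp [strip, div_dirSW_im]

theorem mem_openStrip_dirSW_iff {a b x : ℂ} :
    x ∈ openStrip dirSW a b ↔ a.re - a.im < x.re - x.im ∧ x.re - x.im < b.re - b.im := by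
  simp [openStrip, div_dirSW_im]

/-- The denominator `e^{π i x} - e^{-π i x}` of the integrands. -/
def expDiff (x : ℂ) : ℂ := exp (Real.pi * I * x) - exp (-(Real.pi * I * x))

theorem expDiff_eq_sin (x : ℂ) : expDiff x = 2 * I * sin (Real.pi * x) := by
  have h : Real.pi * I * x = Real.pi * x * I := by ring
  rw [expDiff, h, ← neg_mul]
  linear_combination -I * two_sin (Real.pi * x) +
    (exp (Real.pi * x * I) - exp (-(Real.pi * x) * I)) * I_sq

@[fun_prop] theorem differentiable_expDiff : Differentiable ℂ expDiff := by
  unfold expDiff; fun_prop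

theorem expDiff_neg (x : ℂ) : expDiff (-x) = -expDiff x := by
  simp [expDiff]

theorem expDiff_zero : expDiff 0 = 0 := by
  simp [expDiff]

theorem expDiff_add_intCast (x : ℂ) (n : ℤ) : expDiff (x + n) = (-1) ^ n * expDiff x := by
  rw [expDiff_eq_sin, expDiff_eq_sin, mul_add, mul_comm (Real.pi : ℂ) n,
    sin_antiperiodic.add_int_mul_eq, Int.cast_negOnePow]
  ring

theorem expDiff_eq_zero_iff {x : ℂ} : expDiff x = 0 ↔ ∃ n : ℤ, x = n := by
  have hp : (Real.pi : ℂ) ≠ 0 := by exact_mod_cast Real.pi_ne_zero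
  rw [expDiff_eq_sin, mul_eq_zero, or_iff_right (by simp), Complex.sin_eq_zero_iff]
  refine exists_congr fun n => ?_
  rw [mul_comm, mul_left_inj' hp]

theorem one_le_norm_expDiff {x : ℂ} (hx : 1 ≤ |x.im|) : 1 ≤ ‖expDiff x‖ := by
  wlog him : 1 ≤ x.im generalizing x
  · rw [← norm_neg, ← expDiff_neg]
    exact this (by simpa using hx) (by simpa using (le_abs.1 hx).resolve_left him)
  have hbig : ‖exp (-(Real.pi * I * x))‖ = Real.exp (Real.pi * x.im) := by simp [norm_exp]
  have hsmall : ‖exp (Real.pi * I * x)‖ = Real.exp (-(Real.pi * x.im)) := by simp [norm_exp]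
  have hdiff := norm_sub_norm_le (exp (-(Real.pi * I * x))) (exp (Real.pi * I * x))
  rw [norm_sub_rev, hbig, hsmall, ← expDiff] at hdiff
  have hle : Real.exp (-(Real.pi * x.im)) ≤ 1 := Real.exp_le_one_iff.2 (by
    have := Real.pi_pos; nlinarith)
  nlinarith [Real.pi_gt_three, Real.add_one_le_exp (Real.pi * x.im)]

theorem expGrowthOn_inv_expDiff {d : ℂ} (hd : d.im ≠ 0) (a b : ℂ) :
    ExpGrowthOn (fun x => (expDiff x)⁻¹) (strip d a b) := by
  refine ⟨0, .of_bound 1 ?_⟩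
  filter_upwards [(tendsto_abs_im_strip hd a b).eventually_ge_atTop 1] with x hx
  simpa using inv_le_one_of_one_le₀ (one_le_norm_expDiff hx)

theorem SuperexpDecayOn.div_expDiff {φ : ℂ → ℂ} {a b d : ℂ} (hd : d.im ≠ 0)
    (h : SuperexpDecayOn φ (strip d a b)) :
    SuperexpDecayOn (fun x => φ x / expDiff x) (strip d a b) := by
  simpa only [div_eq_inv_mul] using h.mul (expGrowthOn_inv_expDiff hd a b)

/-! ### Line integrals against the kernel -/

theorem lineIntegrand_congr {f g : ℂ → ℂ} {a d : ℂ} (h : Set.EqOn f g (strip d a a)) :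
    lineIntegrand f a d = lineIntegrand g a d :=
  funext fun u => by rw [lineIntegrand, lineIntegrand, h (add_ofReal_mul_mem_strip a d u)]

theorem lineIntegral_congr {f g : ℂ → ℂ} {a d : ℂ} (h : Set.EqOn f g (strip d a a)) :
    lineIntegral f a d = lineIntegral g a d := by
  rw [lineIntegral, lineIntegral, lineIntegrand_congr h]

theorem lineIntegral_add_point (f : ℂ → ℂ) (a c d : ℂ) :
    lineIntegral f (a + c) d = lineIntegral (fun x => f (x + c)) a d := by
  simp only [lineIntegral, lineIntegrand, add_right_comm a c]

theorem lineIntegral_neg_point (f : ℂ → ℂ) (a d : ℂ) :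
    lineIntegral f (-a) d = lineIntegral (fun x => f (-x)) a d := by
  rw [lineIntegral, ← integral_neg_eq_self]
  simp only [lineIntegral, lineIntegrand, neg_add, ofReal_neg, neg_mul]

theorem lineIntegral_const_mul (c : ℂ) (f : ℂ → ℂ) (a d : ℂ) :
    lineIntegral (fun x => c * f x) a d = c * lineIntegral f a d := by
  simp only [lineIntegral, lineIntegrand, mul_assoc, integral_const_mul]

/-- The closed strip between the paths `m ↘ m+1` and `k ↘ k+1`. -/
def stripSE (m k : ℤ) : Set ℂ := strip dirSE (m + 1 / 2) (k + 1 / 2)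

theorem mem_stripSE_iff {m k : ℤ} {x : ℂ} :
    x ∈ stripSE m k ↔ m + 1 / 2 ≤ x.re + x.im ∧ x.re + x.im ≤ k + 1 / 2 := by
  simp [stripSE, mem_strip_dirSE_iff]

theorem stripSE_mono {m m' k k' : ℤ} (hm : m' ≤ m) (hk : k ≤ k') : stripSE m k ⊆ stripSE m' k' := by
  intro x hx
  rw [mem_stripSE_iff] at hx ⊢
  have hm' : (m' : ℝ) ≤ m := by exact_mod_cast hm
  have hk' : (k : ℝ) ≤ k' := by exact_mod_cast hk
  constructor <;> linarith

theorem stripSE_mem_nhds_intCast (n : ℤ) : stripSE (n - 1) n ∈ 𝓝 (n : ℂ) := by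
  have h : (n : ℂ) ∈ openStrip dirSE ((n - 1 : ℤ) + 1 / 2) (n + 1 / 2) := by
    rw [mem_openStrip_dirSE_iff]
    simp only [add_re, add_im, intCast_re, intCast_im, Int.cast_sub, Int.cast_one]
    constructor <;> (norm_num; try linarith)
  exact mem_of_superset ((isOpen_openStrip _ _ _).mem_nhds h) (openStrip_subset_strip _ _ _)

theorem expDiff_ne_zero_of_mem_stripSE {k : ℤ} {x : ℂ} (hx : x ∈ stripSE k k) : expDiff x ≠ 0 := by
  rw [Ne, expDiff_eq_zero_iff]
  rintro ⟨n, rfl⟩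
  obtain ⟨h, h'⟩ := mem_stripSE_iff.1 hx
  rw [intCast_re, intCast_im, add_zero] at h h'
  have hk : k < n := by exact_mod_cast (by linarith : (k : ℝ) < n)
  have hn : n < k + 1 := by exact_mod_cast (by linarith : (n : ℝ) < k + 1)
  omega

theorem integrable_lineIntegrand_div_expDiff {φ : ℂ → ℂ} {k : ℤ}
    (hc : ContinuousOn φ (stripSE k k)) (hφ : SuperexpDecayOn φ (stripSE k k)) :
    Integrable (lineIntegrand (fun x => φ x / expDiff x) (k + 1 / 2) dirSE) :=
  (hφ.div_expDiff dirSE_im_ne_zero).integrable_lineIntegrand dirSE_ne_zero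
    (hc.div differentiable_expDiff.continuous.continuousOn fun _ => expDiff_ne_zero_of_mem_stripSE)

/-- The integral of `φ(x) / (e^{π i x} - e^{-π i x})` along `k ↘ k+1`. -/
def kernelIntegral (φ : ℂ → ℂ) (k : ℤ) : ℂ :=
  lineIntegral (fun x => φ x / expDiff x) (k + 1 / 2) dirSE

theorem kernelIntegral_congr {φ ψ : ℂ → ℂ} {k : ℤ} (h : Set.EqOn φ ψ (stripSE k k)) :
    kernelIntegral φ k = kernelIntegral ψ k :=
  lineIntegral_congr fun x hx => by simp only [h hx]

theorem kernelIntegral_const_mul (c : ℂ) (φ : ℂ → ℂ) (k : ℤ) :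
    kernelIntegral (fun x => c * φ x) k = c * kernelIntegral φ k := by
  simp only [kernelIntegral, mul_div_assoc, lineIntegral_const_mul]

theorem kernelIntegral_sub {φ ψ : ℂ → ℂ} {k : ℤ} (hφc : ContinuousOn φ (stripSE k k))
    (hφ : SuperexpDecayOn φ (stripSE k k)) (hψc : ContinuousOn ψ (stripSE k k))
    (hψ : SuperexpDecayOn ψ (stripSE k k)) :
    kernelIntegral (fun x => φ x - ψ x) k = kernelIntegral φ k - kernelIntegral ψ k := by
  rw [kernelIntegral, kernelIntegral, kernelIntegral, lineIntegral, lineIntegral, lineIntegral,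
    ← integral_sub (integrable_lineIntegrand_div_expDiff hφc hφ)
      (integrable_lineIntegrand_div_expDiff hψc hψ)]
  simp only [lineIntegrand, sub_div, sub_mul]

theorem kernelIntegral_mul_expDiff (φ : ℂ → ℂ) (k : ℤ) :
    kernelIntegral (fun x => φ x * expDiff x) k = lineIntegral φ (k + 1 / 2) dirSE :=
  lineIntegral_congr fun _ hx => mul_div_cancel_right₀ _ (expDiff_ne_zero_of_mem_stripSE hx)

theorem kernelIntegral_add (φ : ℂ → ℂ) (k n : ℤ) :
    kernelIntegral φ (k + n) = (-1) ^ n * kernelIntegral (fun x => φ (x + n)) k := by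
  have hsign : ((-1 : ℂ) ^ n)⁻¹ = (-1) ^ n := by rw [← inv_zpow, inv_neg_one]
  rw [← kernelIntegral_const_mul, kernelIntegral, kernelIntegral, Int.cast_add, add_right_comm,
    lineIntegral_add_point]
  simp only [expDiff_add_intCast, div_eq_mul_inv, mul_inv, hsign, mul_left_comm, mul_assoc]

theorem kernelIntegral_neg_one_sub (φ : ℂ → ℂ) (k : ℤ) :
    kernelIntegral φ (-1 - k) = -kernelIntegral (fun x => φ (-x)) k := by
  have h : ((-1 - k : ℤ) + 1 / 2 : ℂ) = -(k + 1 / 2) := by push_cast; ring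
  rw [kernelIntegral, kernelIntegral, h, lineIntegral_neg_point, ← neg_one_mul,
    ← lineIntegral_const_mul]
  simp only [expDiff_neg, div_neg, neg_one_mul]

/-! ### Gaussian integrals and residues -/

/-- The Gaussian `e^{2π i p x - π i α x²}`, which decays along the paths `n ↘ n+1`. -/
def quadExp (α : ℝ) (p x : ℂ) : ℂ := exp (2 * Real.pi * I * p * x - Real.pi * I * α * x ^ 2)

@[fun_prop] theorem differentiable_quadExp (α : ℝ) (p : ℂ) : Differentiable ℂ (quadExp α p) := by
  unfold quadExp; fun_prop

theorem superexpDecayOn_quadExp {α : ℝ} (hα : 0 < α) (p a b : ℂ) :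
    SuperexpDecayOn (quadExp α p) (strip dirSE a b) := by
  have h := (superexpDecayOn_gaussian (mul_pos Real.pi_pos hα) dirSE_ne_zero a b).mul
    (expGrowthOn_exp_mul (2 * Real.pi * I * p) _)
  have hquad (x : ℂ) : (x / dirSE) ^ 2 = I * x ^ 2 := by
    rw [div_pow, dirSE_sq, div_eq_iff (neg_ne_zero.2 I_ne_zero)]
    linear_combination x ^ 2 * I_sq
  refine (funext fun x => ?_ : quadExp α p = _) ▸ h
  rw [quadExp, sub_eq_add_neg, Complex.exp_add, hquad]
  push_cast
  ring_nf

theorem lineIntegral_quadExp {α : ℝ} (hα : 0 < α) (p a : ℂ) :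
    lineIntegral (quadExp α p) a dirSE =
      dirSE * (1 / α : ℂ) ^ (1 / 2 : ℂ) * exp (Real.pi * I * p ^ 2 / α) := by
  have hα0 : (α : ℂ) ≠ 0 := ofReal_ne_zero.2 hα.ne'
  have hπ : (Real.pi : ℂ) ≠ 0 := ofReal_ne_zero.2 Real.pi_ne_zero
  have hre : (-(Real.pi * α : ℂ)).re < 0 := by
    rw [← ofReal_mul, ← ofReal_neg, ofReal_re]
    exact neg_neg_of_pos (mul_pos Real.pi_pos hα)
  have hintegrand (u : ℝ) : lineIntegrand (quadExp α p) a dirSE u = exp (-(Real.pi * α) * u ^ 2 +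
      2 * Real.pi * I * (p - α * a) * dirSE * u +
        (2 * Real.pi * I * p * a - Real.pi * I * α * a ^ 2)) * dirSE := by
    rw [lineIntegrand, quadExp]
    congr 2
    linear_combination (-(Real.pi * I * α * u ^ 2)) * dirSE_sq + Real.pi * α * u ^ 2 * I_sq
  have hexponent : 2 * Real.pi * I * p * a - Real.pi * I * α * a ^ 2 -
      (2 * Real.pi * I * (p - α * a) * dirSE) ^ 2 / (4 * -(Real.pi * α)) =
      Real.pi * I * p ^ 2 / α := by
    rw [mul_pow, dirSE_sq]
    field_simp
    linear_combination (-4 * (p - α * a) ^ 2) * I_sq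
  rw [lineIntegral, funext hintegrand, integral_mul_const, integral_cexp_quadratic hre, hexponent,
    neg_neg, div_mul_cancel_left₀ hπ, ← one_div]
  ring

/-- The Mordell integral: the integral of `e^{2π i p x - π i α x²} / (e^{π i x} - e^{-π i x})` along
`0 ↘ 1`. -/
def mordell (α : ℝ) (p : ℂ) : ℂ := kernelIntegral (quadExp α p) 0

theorem quadExp_add_half_sub (α : ℝ) (p x : ℂ) :
    quadExp α (p + 1 / 2) x - quadExp α (p - 1 / 2) x = quadExp α p x * expDiff x := by
  rw [quadExp, quadExp, quadExp, expDiff, mul_sub (exp _), ← Complex.exp_add, ← Complex.exp_add]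
  ring_nf

theorem quadExp_add_one (α : ℝ) (p x : ℂ) :
    quadExp α p (x + 1) = exp (2 * Real.pi * I * p - Real.pi * I * α) * quadExp α (p - α) x := by
  rw [quadExp, quadExp, ← Complex.exp_add]
  ring_nf

theorem mordell_add_half_sub {α : ℝ} (hα : 0 < α) (p : ℂ) :
    mordell α (p + 1 / 2) - mordell α (p - 1 / 2) =
      dirSE * (1 / α : ℂ) ^ (1 / 2 : ℂ) * exp (Real.pi * I * p ^ 2 / α) := by
  rw [mordell, mordell, ← kernelIntegral_sub (differentiable_quadExp _ _).continuous.continuousOn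
    (superexpDecayOn_quadExp hα _ _ _) (differentiable_quadExp _ _).continuous.continuousOn
    (superexpDecayOn_quadExp hα _ _ _)]
  simp only [quadExp_add_half_sub, kernelIntegral_mul_expDiff, lineIntegral_quadExp hα]

theorem kernelIntegral_quadExp_zero_neg_one (α : ℝ) :
    kernelIntegral (quadExp α 0) (-1) = -mordell α 0 := by
  have heven (x : ℂ) : quadExp α 0 (-x) = quadExp α 0 x := by simp [quadExp]
  rw [mordell, show (-1 : ℤ) = -1 - 0 from rfl, kernelIntegral_neg_one_sub, funext heven]

/-- `x ↦ x + 1` and `x ↦ -x` both map a neighbouring path to `0 ↘ 1`; comparing the two evaluates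
the integral, and with it the residue of `1 / (e^{π i x} - e^{-π i x})`. -/
theorem mordell_one_zero : mordell 1 0 = -1 / 2 := by
  have hjump : mordell 1 1 - mordell 1 0 = 1 := by
    have h := mordell_add_half_sub one_pos (1 / 2)
    rw [ofReal_one, div_one, one_cpow, mul_one, div_one, dirSE, ← Complex.exp_add] at h
    convert h using 1
    · norm_num
    · convert Complex.exp_zero.symm using 2; ring
  have hshift : mordell 1 1 = kernelIntegral (quadExp 1 0) (-1) := by
    rw [mordell, ← neg_add_cancel 1, kernelIntegral_add, zpow_one, ← kernelIntegral_const_mul]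
    refine kernelIntegral_congr fun x _ => ?_
    have hexp : exp (2 * Real.pi * I * 1 - Real.pi * I * (1 : ℝ)) = -1 := by
      rw [← exp_pi_mul_I]; push_cast; ring_nf
    rw [Int.cast_one, quadExp_add_one, hexp, ofReal_one, sub_self]
    ring
  linear_combination (-1 / 2) * hjump + (1 / 2) * hshift +
    (1 / 2) * kernelIntegral_quadExp_zero_neg_one 1

theorem dslope_expDiff_zero_ne_zero {x : ℂ} (hx : ∀ n : ℤ, x = n → n = 0) :
    dslope expDiff 0 x ≠ 0 := by
  rcases eq_or_ne x 0 with rfl | hx0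
  · have hderiv := ((hasDerivAt_id' (0 : ℂ)).const_mul (Real.pi : ℂ)).csin.const_mul (2 * I)
    rw [dslope_same, funext expDiff_eq_sin, hderiv.deriv]
    simp [Real.pi_ne_zero]
  · rw [dslope_of_ne _ hx0, slope_def_field, expDiff_zero, sub_zero, sub_zero]
    refine div_ne_zero (fun h => ?_) hx0
    obtain ⟨n, hn⟩ := expDiff_eq_zero_iff.1 h
    exact hx0 (by rw [hn, hx n hn, Int.cast_zero])

theorem eq_zero_of_intCast_mem_stripSE {n : ℤ} (hn : (n : ℂ) ∈ stripSE (-1) 0) : n = 0 := by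
  obtain ⟨h, h'⟩ := mem_stripSE_iff.1 hn
  rw [intCast_re, intCast_im, add_zero] at h h'
  push_cast at h h'
  have hlower : -1 < n := by exact_mod_cast (by linarith : (-1 : ℝ) < n)
  have hupper : n < 1 := by exact_mod_cast (by linarith : (n : ℝ) < 1)
  omega

theorem kernelIntegral_neg_one_eq_of_apply_zero {φ : ℂ → ℂ}
    (hd : DifferentiableOn ℂ φ (stripSE (-1) 0)) (hdec : SuperexpDecayOn φ (stripSE (-1) 0))
    (h0 : φ 0 = 0) :
    kernelIntegral φ (-1) = kernelIntegral φ 0 := by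
  have hnhds : stripSE (-1) 0 ∈ 𝓝 (0 : ℂ) := by simpa using stripSE_mem_nhds_intCast 0
  have hslope {x : ℂ} (hx : x ≠ 0) : dslope φ 0 x / dslope expDiff 0 x = φ x / expDiff x := by
    have hexp : expDiff 0 = 0 := by simp [expDiff]
    rw [dslope_of_ne _ hx, dslope_of_ne _ hx, slope_def_field, slope_def_field, h0, hexp, sub_zero,
      sub_zero, sub_zero, div_div_div_cancel_right₀ hx]
  have hne {x : ℂ} (hx : x ∈ stripSE (-1) 0) : dslope expDiff 0 x ≠ 0 :=
    dslope_expDiff_zero_ne_zero fun n hn => eq_zero_of_intCast_mem_stripSE (hn ▸ hx)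
  have hQ : DifferentiableOn ℂ (fun x => dslope φ 0 x / dslope expDiff 0 x) (stripSE (-1) 0) :=
    ((differentiableOn_dslope hnhds).2 hd).div
      ((differentiableOn_dslope hnhds).2 differentiable_expDiff.differentiableOn) fun _ => hne
  have hQdec := (hdec.div_expDiff dirSE_im_ne_zero).congr
    (ψ := fun x => dslope φ 0 x / dslope expDiff 0 x)
    (((tendsto_norm_cobounded_atTop.eventually_gt_atTop 0).mono
      fun x hx => (hslope (norm_pos_iff.1 hx)).symm))
  have hline {k : ℤ} : kernelIntegral φ k =
      lineIntegral (fun x => dslope φ 0 x / dslope expDiff 0 x) (k + 1 / 2) dirSE :=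
    lineIntegral_congr fun x hx => (hslope fun h0 => expDiff_ne_zero_of_mem_stripSE hx
      (by simp [h0, expDiff])).symm
  rw [hline, hline]
  refine hQdec.lineIntegral_eq dirSE_ne_zero ?_ hQ.continuousOn
    (hQ.mono (openStrip_subset_strip _ _ _))
  rw [div_dirSE_im, div_dirSE_im]
  norm_num

/-- Subtracting `φ 0` times the Gaussian `quadExp 1 0` removes the pole at `0`, so the residue is
read off from `mordell_one_zero`. -/
theorem kernelIntegral_neg_one_sub_zero {φ : ℂ → ℂ} (hd : DifferentiableOn ℂ φ (stripSE (-1) 0))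
    (hdec : SuperexpDecayOn φ (stripSE (-1) 0)) :
    kernelIntegral φ (-1) - kernelIntegral φ 0 = φ 0 := by
  have hgd : Differentiable ℂ fun x => φ 0 * quadExp 1 0 x := by fun_prop
  have hgdec (a b : ℂ) : SuperexpDecayOn (fun x => φ 0 * quadExp 1 0 x) (strip dirSE a b) :=
    (superexpDecayOn_quadExp one_pos 0 a b).mul (expGrowthOn_const (φ 0) _)
  have hsub {k : ℤ} (hk : stripSE k k ⊆ stripSE (-1) 0) :
      kernelIntegral (fun x => φ x - φ 0 * quadExp 1 0 x) k =
        kernelIntegral φ k - φ 0 * kernelIntegral (quadExp 1 0) k := by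
    rw [kernelIntegral_sub (hd.continuousOn.mono hk) (hdec.mono hk) hgd.continuous.continuousOn
      (hgdec _ _), kernelIntegral_const_mul]
  have h := kernelIntegral_neg_one_eq_of_apply_zero (φ := fun x => φ x - φ 0 * quadExp 1 0 x)
    (hd.sub hgd.differentiableOn) (hdec.sub (hgdec _ _)) (by simp [quadExp])
  have hzero : kernelIntegral (quadExp 1 0) 0 = -1 / 2 := mordell_one_zero
  rw [hsub (stripSE_mono le_rfl (by norm_num)), hsub (stripSE_mono (by norm_num) le_rfl),
    kernelIntegral_quadExp_zero_neg_one, mordell_one_zero, hzero] at h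
  linear_combination h

theorem kernelIntegral_sub_one_sub {φ : ℂ → ℂ} {n : ℤ}
    (hd : DifferentiableOn ℂ φ (stripSE (n - 1) n)) (hdec : SuperexpDecayOn φ (stripSE (n - 1) n)) :
    kernelIntegral φ (n - 1) - kernelIntegral φ n = (-1) ^ n * φ n := by
  have hstrip : (· + (n : ℂ)) ⁻¹' stripSE (n - 1) n = stripSE (-1) 0 := by
    ext x
    simp only [Set.mem_preimage, mem_stripSE_iff, add_re, add_im, intCast_re, intCast_im]
    push_cast
    constructor <;> rintro ⟨h, h'⟩ <;> constructor <;> linarith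
  have hdn : DifferentiableOn ℂ (fun x => φ (x + n)) (stripSE (-1) 0) :=
    hd.comp (by fun_prop) hstrip.ge
  have hdecn := hdec.comp_add_const n
  rw [hstrip] at hdecn
  have h := kernelIntegral_neg_one_sub_zero hdn hdecn
  have hshift := kernelIntegral_add φ 0 n
  rw [zero_add] at h hshift
  rw [show n - 1 = -1 + n by ring, kernelIntegral_add, hshift, ← mul_sub, h]

theorem kernelIntegral_eq_add_sum {φ : ℂ → ℂ} {m k : ℤ} (hmk : m ≤ k)
    (hd : DifferentiableOn ℂ φ (stripSE m k)) (hdec : SuperexpDecayOn φ (stripSE m k)) :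
    kernelIntegral φ m = kernelIntegral φ k + ∑ j ∈ Finset.Icc (m + 1) k, (-1) ^ j * φ j := by
  induction k, hmk using Int.leInduction with
  | base => simp
  | succ k hmk ih =>
    have hleft := stripSE_mono (m := m) le_rfl (Int.le_add_one le_rfl : k ≤ k + 1)
    have hright : stripSE (k + 1 - 1) (k + 1) ⊆ stripSE m (k + 1) :=
      stripSE_mono (by omega) le_rfl
    have hjump := kernelIntegral_sub_one_sub (hd.mono hright) (hdec.mono hright)
    rw [add_sub_cancel_right] at hjump
    rw [ih (hd.mono hleft) (hdec.mono hleft), ← Finset.insert_Icc_right_eq_Icc_add_one (by omega),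
      Finset.sum_insert (by simp)]
    linear_combination hjump

theorem mordell_eq_neg_mul_add_one {α : ℝ} (hα : 0 < α) (p : ℂ) :
    mordell α p = -exp (2 * Real.pi * I * p - Real.pi * I * α) * (mordell α (p - α) + 1) := by
  have hjump := kernelIntegral_sub_one_sub (n := 1)
    (differentiable_quadExp α p).differentiableOn (superexpDecayOn_quadExp hα p _ _)
  have hshift := kernelIntegral_add (quadExp α p) 0 1
  have hone : quadExp α p 1 = exp (2 * Real.pi * I * p - Real.pi * I * α) := by simp [quadExp]
  simp only [Int.cast_one, quadExp_add_one, kernelIntegral_const_mul, zpow_one, zero_add] at hshift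
  rw [sub_self, hshift, Int.cast_one, zpow_one, hone] at hjump
  rw [mordell, mordell]
  linear_combination hjump

theorem continuous_mordell {α : ℝ} (hα : 0 < α) : Continuous (mordell α) := by
  have hquad (p x : ℂ) : quadExp α p x / expDiff x =
      exp (p * (2 * Real.pi * I * x)) * (quadExp α 0 x / expDiff x) := by
    rw [quadExp, quadExp, ← mul_div_assoc, ← Complex.exp_add]
    ring_nf
  have hcont : ContinuousOn (fun x => quadExp α 0 x / expDiff x) (stripSE 0 0) :=
    (differentiable_quadExp α 0).continuous.continuousOn.div
      differentiable_expDiff.continuous.continuousOn fun _ => expDiff_ne_zero_of_mem_stripSE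
  have h := ((superexpDecayOn_quadExp hα 0 _ _).div_expDiff
    dirSE_im_ne_zero).differentiable_lineIntegral dirSE_ne_zero hcont
    (ℓ := fun x => 2 * Real.pi * I * x) (by fun_prop)
    ((Asymptotics.isBigO_refl id _).const_mul_left _)
  simp only [← hquad] at h
  exact h.continuous

theorem mordell_one_eq {p : ℂ} (hp : expDiff p ≠ 0) :
    mordell 1 p =
      exp (Real.pi * I * p ^ 2) / expDiff p + 1 / (exp (-(2 * Real.pi * I * p)) - 1) := by
  set E := exp (Real.pi * I * p) with hE
  set E' := exp (-(Real.pi * I * p)) with hE'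
  have hEE' : E * E' = 1 := by rw [← Complex.exp_add, add_neg_cancel, Complex.exp_zero]
  have hhalf : mordell 1 p - mordell 1 (p - 1) = exp (Real.pi * I * p ^ 2) * E' := by
    have h := mordell_add_half_sub one_pos (p - 1 / 2)
    rw [sub_add_cancel, sub_sub, add_halves, ofReal_one, div_one, div_one, one_cpow, mul_one,
      dirSE, ← Complex.exp_add] at h
    rw [h, ← Complex.exp_add]
    ring_nf
  have hperiod : mordell 1 p = E * E * (mordell 1 (p - 1) + 1) := by
    have h := mordell_eq_neg_mul_add_one one_pos p
    rw [ofReal_one, mul_one, Complex.exp_sub, exp_pi_mul_I, div_neg, neg_neg, div_one,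
      show 2 * Real.pi * I * p = Real.pi * I * p + Real.pi * I * p by ring, Complex.exp_add] at h
    exact h
  have hdenom : exp (-(2 * Real.pi * I * p)) - 1 = -(E' * expDiff p) := by
    rw [expDiff, ← hE, ← hE', mul_sub, mul_comm E', hEE', hE', ← Complex.exp_add]
    ring_nf
  have hD : expDiff p = E - E' := rfl
  have hE'0 : E' ≠ 0 := exp_ne_zero _
  rw [hdenom, ← mul_right_inj' (mul_ne_zero hE'0 hp), mul_add, mul_one_div,
    div_neg_self (mul_ne_zero hE'0 hp), mul_assoc E' (expDiff p) (_ / _), mul_div_cancel₀ _ hp, hD]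
  linear_combination hhalf - E' ^ 2 * hperiod + mordell 1 p * hEE' -
    (E * E' + 1) * (mordell 1 (p - 1) + 1) * hEE'

theorem mordell_two_sub (p : ℂ) :
    exp (2 * Real.pi * I * p - 2 * Real.pi * I * p ^ 2) *
      (mordell 2 (2 * p) - mordell 2 (2 * p - 2)) =
        Real.sqrt 2 * exp (3 * Real.pi * I / 8) * sin (Real.pi * p) := by
  set X := exp (2 * Real.pi * I * p - 2 * Real.pi * I * p ^ 2) with hX
  have hconst : (1 / (2 : ℝ) : ℂ) ^ (1 / 2 : ℂ) = (Real.sqrt 2 : ℂ) / 2 := by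
    have h : Real.sqrt (1 / 2) = Real.sqrt 2 / 2 := by
      rw [Real.sqrt_div zero_le_one, Real.sqrt_one, Real.sqrt_div_self']
    rw [← ofReal_one, ← ofReal_div, show (↑(1 : ℝ) / 2 : ℂ) = ((1 / 2 : ℝ) : ℂ) by push_cast; rfl,
      ← ofReal_cpow (by norm_num), ← Real.sqrt_eq_rpow, h]
    push_cast; rfl
  have hhalf (q : ℂ) : mordell 2 (q + 1 / 2) - mordell 2 (q - 1 / 2) =
      dirSE * (Real.sqrt 2 / 2) * exp (Real.pi * I * q ^ 2 / 2) := by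
    rw [mordell_add_half_sub two_pos, hconst, ofReal_ofNat]
  have hupper : X * (dirSE * exp (Real.pi * I * (2 * p - 1 / 2) ^ 2 / 2)) =
      exp (3 * Real.pi * I / 8) * -I * exp (Real.pi * p * I) := by
    rw [← Complex.exp_neg_pi_div_two_mul_I, hX, dirSE, ← Complex.exp_add, ← Complex.exp_add,
      ← Complex.exp_add, ← Complex.exp_add]
    ring_nf
  have hlower : X * (dirSE * exp (Real.pi * I * (2 * p - 3 / 2) ^ 2 / 2)) =
      exp (3 * Real.pi * I / 8) * exp (Real.pi / 2 * I) * exp (-(Real.pi * p) * I) := by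
    rw [hX, dirSE, ← Complex.exp_add, ← Complex.exp_add, ← Complex.exp_add, ← Complex.exp_add]
    ring_nf
  rw [exp_pi_div_two_mul_I] at hlower
  have h₁ := hhalf (2 * p - 1 / 2)
  have h₂ := hhalf (2 * p - 3 / 2)
  rw [sub_add_cancel, sub_sub, add_halves] at h₁
  rw [show 2 * p - 3 / 2 + 1 / 2 = 2 * p - 1 by ring,
    show 2 * p - 3 / 2 - 1 / 2 = 2 * p - 2 by ring] at h₂
  linear_combination X * (h₁ + h₂) + Real.sqrt 2 / 2 * (hupper + hlower) -
    Real.sqrt 2 / 2 * exp (3 * Real.pi * I / 8) * Complex.two_sin (Real.pi * p)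

theorem two_cos_mul_mordell_two (p : ℂ) :
    2 * cos (2 * Real.pi * p) * (exp (-(2 * Real.pi * I * p ^ 2)) * mordell 2 (2 * p)) =
      Real.sqrt 2 * exp (3 * Real.pi * I / 8) * sin (Real.pi * p) -
        exp (2 * Real.pi * I * p - 2 * Real.pi * I * p ^ 2) := by
  set Q := exp (2 * Real.pi * p * I) with hQ
  set Q' := exp (-(2 * Real.pi * p) * I) with hQ'
  set K := exp (-(2 * Real.pi * I * p ^ 2)) with hK
  have hQQ' : Q * Q' = 1 := by
    rw [hQ, hQ', ← Complex.exp_add, ← add_mul, add_neg_cancel, zero_mul, Complex.exp_zero]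
  have hX : exp (2 * Real.pi * I * p - 2 * Real.pi * I * p ^ 2) = K * Q := by
    rw [hK, hQ, ← Complex.exp_add]; ring_nf
  have hperiod : mordell 2 (2 * p) = -(Q * Q) * (mordell 2 (2 * p - 2) + 1) := by
    have hexp : exp (2 * Real.pi * I * (2 * p) - Real.pi * I * (2 : ℝ)) = Q * Q := by
      rw [show 2 * Real.pi * I * (2 * p) - Real.pi * I * (2 : ℝ) =
        2 * Real.pi * p * I + 2 * Real.pi * p * I - 2 * Real.pi * I by push_cast; ring,
        Complex.exp_sub, exp_two_pi_mul_I, div_one, Complex.exp_add]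
    rw [mordell_eq_neg_mul_add_one two_pos, hexp, ofReal_ofNat]
  have hsub := mordell_two_sub p
  have hcos : 2 * cos (2 * Real.pi * p) = Q + Q' := Complex.two_cos _
  rw [hX] at hsub ⊢
  rw [hcos]
  linear_combination hsub + K * Q' * hperiod - K * Q * (mordell 2 (2 * p - 2) + 1) * hQQ'

theorem kernelIntegral_gaussian (k : ℤ) (η : ℂ) :
    kernelIntegral (fun x => exp (-(2 * Real.pi * I * (x - η) ^ 2))) k =
      (-1) ^ k * (exp (-(2 * Real.pi * I * (η - k) ^ 2)) * mordell 2 (2 * (η - k))) := by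
  have hquad (x : ℂ) : exp (-(2 * Real.pi * I * (x + k - η) ^ 2)) =
      exp (-(2 * Real.pi * I * (η - k) ^ 2)) * quadExp 2 (2 * (η - k)) x := by
    rw [quadExp, ← Complex.exp_add, ofReal_ofNat]
    ring_nf
  have h := kernelIntegral_add (fun x => exp (-(2 * Real.pi * I * (x - η) ^ 2))) 0 k
  simp only [hquad, kernelIntegral_const_mul, zero_add] at h
  exact h

theorem riemannQuot_eq_kernelIntegral {k : ℤ} {η : ℂ} (h : cos (2 * Real.pi * η) ≠ 0) :
    riemannQuot k η = kernelIntegral (fun x => exp (-(2 * Real.pi * I * (x - η) ^ 2))) k := by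
  have hcos : cos (2 * Real.pi * (η - k)) = cos (2 * Real.pi * η) := by
    rw [show 2 * Real.pi * (η - k) = 2 * Real.pi * η - k * (2 * Real.pi) by ring,
      Complex.cos_sub_int_mul_two_pi]
  have hsin : sin (Real.pi * (η - k)) = (-1) ^ k * sin (Real.pi * η) := by
    rw [mul_sub, mul_comm (Real.pi : ℂ) k, sin_antiperiodic.sub_int_mul_eq, Int.cast_negOnePow]
  have hexp : exp (2 * Real.pi * I * (η - k) - 2 * Real.pi * I * (η - k) ^ 2) =
      exp (2 * Real.pi * I * η - 2 * Real.pi * I * (η - k) ^ 2) := by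
    rw [show 2 * Real.pi * I * (η - k) - 2 * Real.pi * I * (η - k) ^ 2 =
      2 * Real.pi * I * η - 2 * Real.pi * I * (η - k) ^ 2 - k * (2 * Real.pi * I) by ring,
      Complex.exp_sub, exp_int_mul_two_pi_mul_I, div_one]
  have hsign : ((-1 : ℂ) ^ k) * (-1) ^ k = 1 := by rw [← mul_zpow]; simp
  have hmordell := two_cos_mul_mordell_two (η - k)
  rw [hcos, hsin, hexp] at hmordell
  rw [riemannQuot, div_eq_iff (mul_ne_zero two_ne_zero h), kernelIntegral_gaussian]
  linear_combination (-(-1) ^ k) * hmordell -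
    (Real.sqrt 2 * exp (3 * Real.pi * I / 8) * sin (Real.pi * η)) * hsign

theorem eventually_cos_two_pi_mul_ne_zero (η : ℂ) : ∀ᶠ z in 𝓝[≠] η, cos (2 * Real.pi * z) ≠ 0 := by
  have hanalytic : AnalyticOnNhd ℂ (fun z : ℂ => cos (2 * Real.pi * z)) Set.univ :=
    DifferentiableOn.analyticOnNhd (by fun_prop) isOpen_univ
  by_contra h
  have hzero := hanalytic.eqOn_zero_of_preconnected_of_frequently_eq_zero isPreconnected_univ
    (Set.mem_univ η) (by simpa using h) (Set.mem_univ 0)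
  simp at hzero

theorem tendsto_riemannQuot (k : ℤ) (η : ℂ) : Tendsto (riemannQuot k) (𝓝[≠] η)
    (𝓝 (kernelIntegral (fun x => exp (-(2 * Real.pi * I * (x - η) ^ 2))) k)) := by
  have hcont : Continuous fun z =>
      kernelIntegral (fun x => exp (-(2 * Real.pi * I * (x - z) ^ 2))) k := by
    have := continuous_mordell two_pos
    simp only [kernelIntegral_gaussian]
    fun_prop
  refine ((hcont.tendsto η).mono_left nhdsWithin_le_nhds).congr' ?_
  filter_upwards [eventually_cos_two_pi_mul_ne_zero η] with z hz
  exact (riemannQuot_eq_kernelIntegral hz).symm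

theorem riemannTerm_eq_kernelIntegral (k : ℤ) (η : ℂ) :
    riemannTerm k η = kernelIntegral (fun x => exp (-(2 * Real.pi * I * (x - η) ^ 2))) k :=
  (tendsto_riemannQuot k η).limUnder_eq

/-! ### Mellin transforms of superpositions of exponentials -/

theorem norm_cpow_sub_one_mul_exp_neg_mul {a r : ℂ} {t : ℝ} (ht : 0 < t) :
    ‖(t : ℂ) ^ (a - 1) * exp (-(r * t))‖ = t ^ (a.re - 1) * Real.exp (-(r.re * t)) := by
  rw [norm_mul, norm_cpow_eq_rpow_re_of_pos ht, norm_exp]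
  simp

theorem integrableOn_rpow_mul_exp_neg_mul_Ioi {a r : ℝ} (ha : 0 < a) (hr : 0 < r) :
    IntegrableOn (fun t : ℝ => t ^ (a - 1) * Real.exp (-(r * t))) (Set.Ioi 0) := by
  simpa using integrableOn_rpow_mul_exp_neg_mul_rpow (s := a - 1) (p := 1) (by linarith) one_pos hr

theorem mellinConvergent_exp_neg_mul {a r : ℂ} (ha : 0 < a.re) (hr : 0 < r.re) :
    MellinConvergent (fun t => exp (-(r * t))) a := by
  refine (integrableOn_rpow_mul_exp_neg_mul_Ioi ha hr).mono' (by fun_prop) ?_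
  filter_upwards [ae_restrict_mem measurableSet_Ioi] with t ht
  exact (norm_cpow_sub_one_mul_exp_neg_mul ht).le

theorem differentiableAt_mellin_exp_neg_mul {a r : ℂ} (ha : 0 < a.re) (hr : 0 < r.re) :
    DifferentiableAt ℂ (fun r => mellin (fun t => exp (-(r * t))) a) r := by
  have h := differentiableAt_integral_exp_mul (μ := volume.restrict (Set.Ioi (0 : ℝ)))
    (L := fun t => -t) (h := fun t => (t : ℂ) ^ (a - 1)) (z := r) (half_pos hr) (by fun_prop)
    (measurable_ofReal.pow_const _).aestronglyMeasurable
    ((integrableOn_rpow_mul_exp_neg_mul_Ioi ha (half_pos hr)).congr ?_)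
  · simpa only [mellin, smul_eq_mul, mul_neg, mul_comm] using h
  · filter_upwards [ae_restrict_mem measurableSet_Ioi] with t ht
    rw [mul_comm (exp _), mul_neg, norm_cpow_sub_one_mul_exp_neg_mul ht, norm_neg, norm_real,
      Real.norm_of_nonneg (le_of_lt ht), mul_left_comm, ← Real.exp_add]
    ring_nf

theorem hasMellin_exp_neg_mul {a r : ℂ} (ha : 0 < a.re) (hr : 0 < r.re) :
    HasMellin (fun t => exp (-(r * t))) a (r ^ (-a) * Gamma a) := by
  refine ⟨mellinConvergent_exp_neg_mul ha hr, ?_⟩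
  have hopen : IsOpen {z : ℂ | 0 < z.re} := isOpen_lt continuous_const continuous_re
  have hmellin : AnalyticOnNhd ℂ (fun r => mellin (fun t => exp (-(r * t))) a) {z | 0 < z.re} :=
    DifferentiableOn.analyticOnNhd
      (fun z hz => (differentiableAt_mellin_exp_neg_mul ha hz).differentiableWithinAt) hopen
  have hpow : AnalyticOnNhd ℂ (fun r => r ^ (-a) * Gamma a) {z | 0 < z.re} :=
    DifferentiableOn.analyticOnNhd (fun z hz =>
      ((differentiableAt_id.cpow_const (.inl hz)).mul_const _).differentiableWithinAt) hopen
  have hreal {x : ℝ} (hx : 0 < x) :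
      mellin (fun t => exp (-(x * t))) a = (x : ℂ) ^ (-a) * Gamma a := by
    simp only [mellin, smul_eq_mul]
    rw [Complex.integral_cpow_mul_exp_neg_mul_Ioi ha hx, cpow_neg, one_div, inv_cpow]
    rw [arg_ofReal_of_nonneg hx.le]
    exact Real.pi_pos.ne
  have htendsto : Tendsto ((↑) : ℝ → ℂ) (𝓝[>] 1) (𝓝[≠] 1) := by
    refine tendsto_nhdsWithin_iff.2 ⟨?_, ?_⟩
    · simpa using (continuous_ofReal.tendsto (1 : ℝ)).mono_left nhdsWithin_le_nhds
    · filter_upwards [self_mem_nhdsWithin] with x hx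
      simpa using ne_of_gt hx
  refine hmellin.eqOn_of_preconnected_of_frequently_eq hpow
    (convex_halfSpace_re_gt 0).isPreconnected (by simp : (1 : ℂ) ∈ {z : ℂ | 0 < z.re})
    (htendsto.frequently (Eventually.frequently ?_)) hr
  filter_upwards [self_mem_nhdsWithin] with x hx using hreal (zero_lt_one.trans hx)

theorem hasMellin_integral_exp_neg_mul {Y : Type*} [MeasurableSpace Y] {μ : Measure Y} [SFinite μ]
    {r A : Y → ℂ} {a : ℂ} (ha : 0 < a.re) (hr : ∀ y, 0 < (r y).re) (hrm : Measurable r)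
    (hA : AEStronglyMeasurable A μ)
    (hint : Integrable (fun y => (1 / (r y).re) ^ a.re * ‖A y‖) μ) :
    HasMellin (fun t => ∫ y, exp (-(r y * t)) * A y ∂μ) a
      (Gamma a * ∫ y, r y ^ (-a) * A y ∂μ) := by
  set Φ : ℝ × Y → ℂ := fun p => (p.1 : ℂ) ^ (a - 1) * exp (-(r p.2 * p.1)) * A p.2 with hΦ
  have hmeas : AEStronglyMeasurable Φ ((volume.restrict (Set.Ioi 0)).prod μ) := by
    refine AEStronglyMeasurable.mul ?_ hA.comp_snd
    exact (by fun_prop : Measurable fun p : ℝ × Y =>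
      (p.1 : ℂ) ^ (a - 1) * exp (-(r p.2 * p.1))).aestronglyMeasurable
  have hslice (y : Y) : IntegrableOn (fun t => Φ (t, y)) (Set.Ioi 0) :=
    (mellinConvergent_exp_neg_mul ha (hr y)).mul_const (A y)
  have hnorm (y : Y) : ∫ t in Set.Ioi 0, ‖Φ (t, y)‖ =
      Real.Gamma a.re * ((1 / (r y).re) ^ a.re * ‖A y‖) := by
    simp only [hΦ, norm_mul _ (A y), integral_mul_const]
    rw [setIntegral_congr_fun measurableSet_Ioi fun t ht => norm_cpow_sub_one_mul_exp_neg_mul ht,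
      Real.integral_rpow_mul_exp_neg_mul_Ioi ha (hr y)]
    ring
  have hΦint : Integrable Φ ((volume.restrict (Set.Ioi 0)).prod μ) :=
    (integrable_prod_iff' hmeas).2
      ⟨.of_forall hslice, by simpa only [hnorm] using hint.const_mul (Real.Gamma a.re)⟩
  have hfactor (t : ℝ) :
      (t : ℂ) ^ (a - 1) • ∫ y, exp (-(r y * t)) * A y ∂μ = ∫ y, Φ (t, y) ∂μ := by
    simp only [hΦ, mul_assoc, integral_const_mul, smul_eq_mul]
  refine ⟨?_, ?_⟩
  · simpa only [MellinConvergent, IntegrableOn, hfactor] using hΦint.integral_prod_left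
  · simp only [mellin, hfactor]
    rw [integral_integral_swap hΦint, ← integral_const_mul]
    refine integral_congr_ae (.of_forall fun y => ?_)
    have hy := (hasMellin_exp_neg_mul ha (hr y)).2
    simp only [mellin, smul_eq_mul] at hy
    simp only [hΦ, integral_mul_const, hy]
    ring

/-! ### Powers on the half-plane to the right of the saddle path -/

theorem mul_cpow_of_arg_add_arg_mem {x y : ℂ} (h : arg x + arg y ∈ Set.Ioc (-Real.pi) Real.pi)
    (w : ℂ) : (x * y) ^ w = x ^ w * y ^ w := by
  rcases eq_or_ne w 0 with rfl | hw
  · simp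
  rcases eq_or_ne x 0 with rfl | hx
  · simp [hw]
  rcases eq_or_ne y 0 with rfl | hy
  · simp [hw]
  rw [cpow_def_of_ne_zero (mul_ne_zero hx hy), (log_mul_eq_add_log_iff hx hy).2 h, add_mul,
    Complex.exp_add, cpow_def_of_ne_zero hx, cpow_def_of_ne_zero hy]

theorem re_add_im_eq_norm_mul_sin (x : ℂ) :
    x.re + x.im = Real.sqrt 2 * ‖x‖ * Real.sin (arg x + Real.pi / 4) := by
  have h2 : Real.sqrt 2 * Real.sqrt 2 = 2 := Real.mul_self_sqrt two_pos.le
  rw [Real.sin_add, Real.cos_pi_div_four, Real.sin_pi_div_four]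
  linear_combination -norm_mul_cos_arg x - norm_mul_sin_arg x -
    ‖x‖ * (Real.sin (arg x) + Real.cos (arg x)) / 2 * h2

theorem re_add_im_pos_iff {x : ℂ} :
    0 < x.re + x.im ↔ x ≠ 0 ∧ arg x ∈ Set.Ioo (-(Real.pi / 4)) (3 * Real.pi / 4) := by
  rw [re_add_im_eq_norm_mul_sin]
  constructor
  · intro h
    have hx : x ≠ 0 := by rintro rfl; simp at h
    have hsin : 0 < Real.sin (arg x + Real.pi / 4) := pos_of_mul_pos_right h (by positivity)
    refine ⟨hx, ?_, ?_⟩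
    · by_contra! hle
      exact hsin.not_ge (Real.sin_nonpos_of_nonpos_of_neg_pi_le (by linarith)
        (by linarith [neg_pi_lt_arg x, Real.pi_pos]))
    · by_contra! hge
      rw [← neg_neg (Real.sin _), ← Real.sin_sub_pi, neg_pos] at hsin
      exact hsin.not_ge (Real.sin_nonneg_of_nonneg_of_le_pi (by linarith)
        (by linarith [arg_le_pi x, Real.pi_pos]))
  · rintro ⟨hx, h, h'⟩
    have := Real.sin_pos_of_pos_of_lt_pi (x := arg x + Real.pi / 4) (by linarith) (by linarith)
    positivity

theorem log_dirSE : log dirSE = -(Real.pi * I / 4) := by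
  have him : (-(Real.pi * I / 4)).im = -(Real.pi / 4) := by simp
  rw [dirSE, log_exp] <;> rw [him] <;> linarith [Real.pi_pos]

theorem log_neg_dirSW : log (-dirSW) = Real.pi * I / 4 := by
  have him : (Real.pi * I / 4).im = Real.pi / 4 := by simp
  have hexp : -dirSW = exp (Real.pi * I / 4) := by
    rw [dirSW, show 5 * Real.pi * I / 4 = Real.pi * I / 4 + Real.pi * I by ring, Complex.exp_add,
      exp_pi_mul_I, mul_neg_one, neg_neg]
  rw [hexp, log_exp] <;> rw [him] <;> linarith [Real.pi_pos]

theorem log_dirSW : log dirSW = -(3 * Real.pi * I / 4) := by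
  have him : (-(3 * Real.pi * I / 4)).im = -(3 * Real.pi / 4) := by simp
  have hexp : dirSW = exp (-(3 * Real.pi * I / 4)) := by
    rw [dirSW, show 5 * Real.pi * I / 4 = -(3 * Real.pi * I / 4) + 2 * Real.pi * I by ring,
      Complex.exp_add, exp_two_pi_mul_I, mul_one]
  rw [hexp, log_exp] <;> rw [him] <;> linarith [Real.pi_pos]

theorem arg_two_pi_mul_dirSE : arg (2 * Real.pi * dirSE) = -(Real.pi / 4) := by
  have h := congrArg im log_dirSE
  rw [log_im] at h
  rw [← ofReal_ofNat, ← ofReal_mul, arg_real_mul _ Real.two_pi_pos, h]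
  simp

theorem two_pi_mul_dirSE_mul_cpow {x : ℂ} (hx : 0 < x.re + x.im) (w : ℂ) :
    (2 * Real.pi * dirSE * x) ^ w = (2 * Real.pi * dirSE) ^ w * x ^ w := by
  obtain ⟨-, h, h'⟩ := re_add_im_pos_iff.1 hx
  refine mul_cpow_of_arg_add_arg_mem ?_ w
  rw [arg_two_pi_mul_dirSE]
  constructor <;> linarith [Real.pi_pos]

theorem two_pi_mul_dirSE_mul_re (x : ℂ) :
    (2 * Real.pi * dirSE * x).re = Real.pi * Real.sqrt 2 * (x.re + x.im) := by
  rw [← ofReal_ofNat, ← ofReal_mul, mul_assoc, re_ofReal_mul, mul_re, dirSE_re, dirSE_im]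
  ring

/-! ### The two Mellin transforms -/

theorem integral_count_eq_tsum {Y : Type*} [Countable Y] [MeasurableSpace Y]
    [DiscreteMeasurableSpace Y] (f : Y → ℂ) : ∫ y, f y ∂Measure.count = ∑' y, f y := by
  by_cases hf : Integrable f Measure.count
  · simp [integral_countable hf]
  · rw [integral_undef hf, tsum_eq_zero_of_not_summable]
    rwa [← summable_norm_iff, ← integrable_count_iff]

theorem hasMellin_congr {f g : ℝ → ℂ} {a m : ℂ} (h : HasMellin f a m)
    (hfg : Set.EqOn f g (Set.Ioi 0)) : HasMellin g a m := by
  have hcongr : Set.EqOn (fun t : ℝ => (t : ℂ) ^ (a - 1) • f t) (fun t => (t : ℂ) ^ (a - 1) • g t)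
      (Set.Ioi 0) := fun t ht => by simp only [hfg ht]
  refine ⟨h.1.congr_fun hcongr measurableSet_Ioi, ?_⟩
  rw [← h.2, mellin, mellin, setIntegral_congr_fun measurableSet_Ioi hcongr]

theorem tsum_exp_neg_mul_add_one {x : ℂ} (hx : 0 < x.re) :
    ∑' n : ℕ, exp (-(x * (n + 1))) = 1 / (exp x - 1) := by
  have hnorm : ‖exp (-x)‖ < 1 := by rw [norm_exp]; simpa using hx
  have hne : 1 - exp (-x) ≠ 0 := sub_ne_zero.2 fun h => by simp [← h] at hnorm
  have hterm (n : ℕ) : exp (-(x * (n + 1))) = exp (-x) * exp (-x) ^ n := by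
    rw [← Complex.exp_nat_mul, ← Complex.exp_add]
    ring_nf
  have hinv : exp x * exp (-x) = 1 := by rw [← Complex.exp_add, add_neg_cancel, Complex.exp_zero]
  have hne' : exp x - 1 ≠ 0 := by
    rw [show exp x - 1 = exp x * (1 - exp (-x)) by rw [mul_sub, hinv, mul_one]]
    exact mul_ne_zero (exp_ne_zero x) hne
  simp only [hterm]
  rw [tsum_mul_left, tsum_geometric_of_norm_lt_one hnorm, ← div_eq_mul_inv, div_eq_div_iff hne hne']
  linear_combination hinv

theorem hasMellin_one_div_exp_mul_sub_one {a r : ℂ} (ha : 1 < a.re) (hr : 0 < r.re) :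
    HasMellin (fun u => 1 / (exp (r * u) - 1)) a (Gamma a * (r ^ (-a) * riemannZeta a)) := by
  have hre (n : ℕ) : (r * (n + 1)).re = r.re * (n + 1 : ℕ) := by simp
  have hpow (n : ℕ) : (r * (n + 1)) ^ (-a) = r ^ (-a) * (1 / (n + 1 : ℂ) ^ a) := by
    rw [mul_cpow_of_arg_add_arg_mem, cpow_neg (n + 1 : ℂ), one_div]
    rw [← Nat.cast_add_one, natCast_arg, add_zero]
    exact arg_mem_Ioc r
  have hsum : Summable fun n : ℕ => (1 / (r * (n + 1)).re) ^ a.re := by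
    have hterm (n : ℕ) : (1 / (r * (n + 1)).re) ^ a.re =
        (1 / r.re) ^ a.re * (1 / ((n + 1 : ℕ) : ℝ) ^ a.re) := by
      rw [hre, ← one_div_mul_one_div, Real.mul_rpow (by positivity) (by positivity),
        Real.div_rpow zero_le_one (Nat.cast_nonneg (n + 1)), Real.one_rpow]
    simp only [hterm]
    exact ((summable_nat_add_iff 1).2 (Real.summable_one_div_nat_rpow.2 ha)).mul_left _
  have hmellin := hasMellin_integral_exp_neg_mul (μ := Measure.count)
    (r := fun n : ℕ => r * (n + 1)) (A := fun _ => 1) (a := a) (zero_lt_one.trans ha)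
    (fun n => by rw [hre]; positivity) (by fun_prop) (by fun_prop)
    (integrable_count_iff.2 (by simpa only [norm_one, mul_one] using hsum.norm))
  simp only [mul_one, integral_count_eq_tsum, hpow, tsum_mul_left,
    ← zeta_eq_tsum_one_div_nat_add_one_cpow ha] at hmellin
  refine hasMellin_congr hmellin fun u hu => ?_
  simp only [mul_right_comm r]
  exact tsum_exp_neg_mul_add_one (by simpa using mul_pos hr hu)

theorem hasMellin_mordell {α : ℝ} (hα : 0 < α) {a : ℂ} (ha : 0 < a.re) :
    HasMellin (fun u => mordell α (-dirSW * u)) a (Gamma a *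
      ((2 * Real.pi * dirSE) ^ (-a) * kernelIntegral (fun x => x ^ (-a) * quadExp α 0 x) 0)) := by
  set X : ℝ → ℂ := fun v => (0 : ℤ) + 1 / 2 + v * dirSE with hX
  have hline (v : ℝ) : (X v).re + (X v).im = 1 / 2 := by simp [hX, dirSE_re, dirSE_im]
  have hint := integrable_lineIntegrand_div_expDiff (k := 0)
    (differentiable_quadExp α 0).continuous.continuousOn (superexpDecayOn_quadExp hα 0 _ _)
  have hmellin := hasMellin_integral_exp_neg_mul (r := fun v => 2 * Real.pi * dirSE * X v) ha
    (fun v => by rw [two_pi_mul_dirSE_mul_re, hline]; positivity) (by fun_prop)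
    hint.aestronglyMeasurable
    (by simpa only [two_pi_mul_dirSE_mul_re, hline] using hint.norm.const_mul _)
  have hpow (v : ℝ) : (2 * Real.pi * dirSE * X v) ^ (-a) =
      (2 * Real.pi * dirSE) ^ (-a) * X v ^ (-a) :=
    two_pi_mul_dirSE_mul_cpow (by rw [hline]; norm_num) _
  have hquad (u v : ℝ) : exp (-(2 * Real.pi * dirSE * X v * u)) * quadExp α 0 (X v) =
      quadExp α (-dirSW * u) (X v) := by
    rw [quadExp, quadExp, ← Complex.exp_add, dirSW_eq_neg_I_mul_dirSE]
    congr 1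
    linear_combination (-2 * Real.pi * dirSE * u * X v) * I_sq
  convert! hmellin using 2 with u
  · refine integral_congr_ae (.of_forall fun v => ?_)
    change quadExp α (-dirSW * u) (X v) / expDiff (X v) * dirSE =
      exp (-(2 * Real.pi * dirSE * X v * u)) * (quadExp α 0 (X v) / expDiff (X v) * dirSE)
    rw [← hquad]
    ring
  · rw [kernelIntegral, lineIntegral, ← integral_const_mul]
    refine integral_congr_ae (.of_forall fun v => ?_)
    simp only [lineIntegrand, hpow]
    simp only [hX]
    ring

/-! ### The functional equation to the left of `-1` -/

theorem exp_pi_mul_I_mul_sq_eq (x : ℂ) :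
    exp (Real.pi * I * x ^ 2) = exp (-Real.pi * (x / dirSW) ^ 2) := by
  rw [div_pow, dirSW_sq, div_I]
  ring_nf

theorem superexpDecayOn_auxIntegrand (s a b : ℂ) :
    SuperexpDecayOn (auxIntegrand s) (strip dirSW a b) := by
  have hgauss := superexpDecayOn_gaussian Real.pi_pos dirSW_ne_zero a b
  simp only [← exp_pi_mul_I_mul_sq_eq] at hgauss
  exact (hgauss.mul (expGrowthOn_cpow_const (-s) _)).div_expDiff dirSW_im_ne_zero

theorem auxIntegrand_eq_dslope {s : ℂ} (hs : s.re < -1) (x : ℂ) :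
    auxIntegrand s x = x ^ (-s - 1) * exp (Real.pi * I * x ^ 2) / dslope expDiff 0 x := by
  change x ^ (-s) * exp (Real.pi * I * x ^ 2) / expDiff x = _
  rcases eq_or_ne x 0 with rfl | hx
  · have h : -s ≠ 0 := by rintro h; simp [neg_eq_zero.1 h] at hs; linarith
    have h' : -s - 1 ≠ 0 := by
      rintro h
      rw [show s = -1 by linear_combination -h] at hs
      simp at hs
    rw [zero_cpow h, zero_cpow h', zero_mul, expDiff_zero, div_zero, zero_div]
  · rw [dslope_of_ne _ hx, slope_def_field, expDiff_zero, sub_zero, sub_zero, cpow_sub _ _ hx,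
      cpow_one]
    field_simp

theorem re_sub_im_mem_of_mem_strip_dirSW {x : ℂ} (hx : x ∈ strip dirSW 0 (1 / 2)) :
    x.re - x.im ∈ Set.Icc 0 (1 / 2) := by
  simpa using mem_strip_dirSW_iff.1 hx

theorem eq_zero_of_intCast_mem_strip_dirSW {n : ℤ} (hn : (n : ℂ) ∈ strip dirSW 0 (1 / 2)) :
    n = 0 := by
  obtain ⟨h, h'⟩ := re_sub_im_mem_of_mem_strip_dirSW hn
  rw [intCast_re, intCast_im, sub_zero] at h h'
  have hupper : n < 1 := by exact_mod_cast h'.trans_lt one_half_lt_one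
  have hlower : 0 ≤ n := by exact_mod_cast h
  omega

theorem dslope_expDiff_zero_ne_zero_of_mem_strip_dirSW {x : ℂ} (hx : x ∈ strip dirSW 0 (1 / 2)) :
    dslope expDiff 0 x ≠ 0 :=
  dslope_expDiff_zero_ne_zero fun _ hn => eq_zero_of_intCast_mem_strip_dirSW (hn ▸ hx)

theorem differentiable_dslope_expDiff_zero : Differentiable ℂ (dslope expDiff 0) :=
  differentiableOn_univ.1 ((differentiableOn_dslope univ_mem).2
    differentiable_expDiff.differentiableOn)

theorem continuousOn_auxIntegrand {s : ℂ} (hs : s.re < -1) :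
    ContinuousOn (auxIntegrand s) (strip dirSW 0 (1 / 2)) := by
  rw [funext (auxIntegrand_eq_dslope hs)]
  intro x hx
  have hre : 0 ≤ x.re ∨ x.im ≠ 0 := by
    by_contra! h
    linarith [(re_sub_im_mem_of_mem_strip_dirSW hx).1]
  have hcpow := continuousAt_cpow_const_of_re_pos (w := -s - 1) hre
    (by rw [sub_re, neg_re, one_re]; linarith)
  exact ((hcpow.mul (by fun_prop)).div differentiable_dslope_expDiff_zero.continuous.continuousAt
    (dslope_expDiff_zero_ne_zero_of_mem_strip_dirSW hx)).continuousWithinAt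

theorem mem_slitPlane_of_re_sub_im_pos {x : ℂ} (hx : 0 < x.re - x.im) : x ∈ slitPlane := by
  rw [mem_slitPlane_iff]
  by_contra! h
  linarith

theorem differentiableOn_auxIntegrand {s : ℂ} (hs : s.re < -1) :
    DifferentiableOn ℂ (auxIntegrand s) (openStrip dirSW 0 (1 / 2)) := by
  rw [funext (auxIntegrand_eq_dslope hs)]
  intro x hx
  have hslit : x ∈ slitPlane :=
    mem_slitPlane_of_re_sub_im_pos (by simpa using (mem_openStrip_dirSW_iff.1 hx).1)
  have hcpow : DifferentiableAt ℂ (fun x => x ^ (-s - 1)) x := differentiableAt_id.cpow_const hslit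
  exact ((hcpow.mul (by fun_prop)).div differentiable_dslope_expDiff_zero.differentiableAt
    (dslope_expDiff_zero_ne_zero_of_mem_strip_dirSW
      (openStrip_subset_strip _ _ _ hx))).differentiableWithinAt

theorem riemannAux_eq_lineIntegral_zero {s : ℂ} (hs : s.re < -1) :
    riemannAux s = lineIntegral (auxIntegrand s) 0 dirSW :=
  (SuperexpDecayOn.lineIntegral_eq dirSW_ne_zero (by rw [div_dirSW_im, div_dirSW_im]; simp)
    (continuousOn_auxIntegrand hs) (differentiableOn_auxIntegrand hs)
    (superexpDecayOn_auxIntegrand s _ _)).symm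

theorem integrable_lineIntegrand_auxIntegrand_zero {s : ℂ} (hs : s.re < -1) :
    Integrable (lineIntegrand (auxIntegrand s) 0 dirSW) :=
  (superexpDecayOn_auxIntegrand s 0 0).integrable_lineIntegrand dirSW_ne_zero
    ((continuousOn_auxIntegrand hs).mono
      (strip_subset_strip (by simp [mem_strip_dirSW_iff]) (by simp [mem_strip_dirSW_iff])))

theorem auxIntegrand_mul_ofReal (s x : ℂ) {u : ℝ} (hu : 0 ≤ u) :
    auxIntegrand s (x * u) =
      x ^ (-s) * ((u : ℂ) ^ (-s) * (exp (Real.pi * I * (x * u) ^ 2) / expDiff (x * u))) := by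
  change (x * u) ^ (-s) * _ / expDiff (x * u) = _
  rw [mul_cpow_of_arg_add_arg_mem (by rw [arg_ofReal_of_nonneg hu, add_zero]; exact arg_mem_Ioc x)]
  ring

theorem integral_eq_integral_Ioi_add_neg {g : ℝ → ℂ} (hg : Integrable g) :
    ∫ u, g u = (∫ u in Set.Ioi 0, g u) + ∫ u in Set.Ioi 0, g (-u) := by
  rw [integral_comp_neg_Ioi, neg_zero, add_comm,
    intervalIntegral.integral_Iic_add_Ioi hg.integrableOn hg.integrableOn]

theorem riemannAux_eq_mellin {s : ℂ} (hs : s.re < -1) :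
    riemannAux s = dirSW * ((-dirSW) ^ (-s) - dirSW ^ (-s)) *
      mellin (fun u => exp (Real.pi * I * (-dirSW * u) ^ 2) / expDiff (-dirSW * u)) (1 - s) := by
  rw [riemannAux_eq_lineIntegral_zero hs, lineIntegral,
    integral_eq_integral_Ioi_add_neg (integrable_lineIntegrand_auxIntegrand_zero hs), mellin,
    mul_sub, sub_mul, add_comm, sub_eq_add_neg, ← neg_mul, ← integral_const_mul,
    ← integral_const_mul]
  congr 1 <;> refine setIntegral_congr_fun measurableSet_Ioi fun u hu => ?_
  · simp only [lineIntegrand, smul_eq_mul]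
    rw [show (0 : ℂ) + (-u : ℝ) * dirSW = -dirSW * u by push_cast; ring,
      auxIntegrand_mul_ofReal s _ (le_of_lt hu), sub_sub_cancel_left]
    ring
  · simp only [lineIntegrand, smul_eq_mul]
    rw [show (0 : ℂ) + u * dirSW = dirSW * u by ring, auxIntegrand_mul_ofReal s _ (le_of_lt hu),
      sub_sub_cancel_left, neg_mul dirSW, expDiff_neg, neg_sq]
    ring

/-- The analogue of `riemannAux` with the integrand `x^{s-1} e^{-π i x²} / (e^{π i x} - e^{-π i x})`
and the path `0 ↘ 1`, linked to `riemannAux` by the functional equation. -/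
def dualAux (s : ℂ) : ℂ :=
  kernelIntegral (fun x => x ^ (s - 1) * quadExp 1 0 x) 0

theorem expDiff_neg_dirSW_mul_ne_zero {u : ℝ} (hu : 0 < u) : expDiff (-dirSW * u) ≠ 0 := by
  intro h
  obtain ⟨n, hn⟩ := expDiff_eq_zero_iff.1 h
  have him := congrArg im hn
  rw [im_mul_ofReal, intCast_im, neg_im, mul_eq_zero, neg_eq_zero] at him
  exact him.elim dirSW_im_ne_zero hu.ne'

theorem mellin_gaussian_div_expDiff {a : ℂ} (ha : 1 < a.re) :
    mellin (fun u => exp (Real.pi * I * (-dirSW * u) ^ 2) / expDiff (-dirSW * u)) a =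
      Gamma a * (2 * Real.pi * dirSE) ^ (-a) * (dualAux (1 - a) - riemannZeta a) := by
  have hmordell := hasMellin_mordell one_pos (zero_lt_one.trans ha)
  have hzeta := hasMellin_one_div_exp_mul_sub_one (r := 2 * Real.pi * dirSE) ha
    (by rw [← ofReal_ofNat, ← ofReal_mul, re_ofReal_mul, dirSE_re]; positivity)
  have hsub := hasMellin_congr (hasMellin_sub hmordell.1 hzeta.1)
    (g := fun u => exp (Real.pi * I * (-dirSW * u) ^ 2) / expDiff (-dirSW * u)) fun u hu => by
      have harg : -(2 * Real.pi * I * (-dirSW * u)) = 2 * Real.pi * dirSE * u := by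
        rw [dirSW_eq_neg_I_mul_dirSE]
        linear_combination (-2 * Real.pi * dirSE * u) * I_sq
      simp only [mordell_one_eq (expDiff_neg_dirSW_mul_ne_zero hu), harg, add_sub_cancel_right]
  rw [hsub.2, hmordell.2, hzeta.2, dualAux, sub_sub_cancel_left]
  ring

theorem dirSW_mul_cpow_sub_mul_dirSE_cpow (s : ℂ) :
    dirSW * ((-dirSW) ^ (-s) - dirSW ^ (-s)) * dirSE ^ (s - 1) = -(2 * sin (Real.pi * s / 2)) := by
  have hexp : dirSW = -exp (Real.pi * I / 4) := by
    rw [← log_neg_dirSW, exp_log (neg_ne_zero.2 dirSW_ne_zero), neg_neg]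
  have hSE : dirSE ^ (s - 1) = exp (-(Real.pi * I / 4) * (s - 1)) := by
    rw [cpow_def_of_ne_zero dirSE_ne_zero, log_dirSE]
  have hpos : -dirSW * (-dirSW) ^ (-s) * dirSE ^ (s - 1) =
      exp (Real.pi / 2 * I) * exp (-(Real.pi * s / 2) * I) := by
    rw [cpow_def_of_ne_zero (neg_ne_zero.2 dirSW_ne_zero), log_neg_dirSW, hSE, hexp, neg_neg,
      ← Complex.exp_add, ← Complex.exp_add, ← Complex.exp_add]
    ring_nf
  have hneg : -dirSW * dirSW ^ (-s) * dirSE ^ (s - 1) =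
      exp (Real.pi / 2 * I) * exp (Real.pi * s / 2 * I) := by
    rw [cpow_def_of_ne_zero dirSW_ne_zero, log_dirSW, hSE, hexp, neg_neg,
      ← Complex.exp_add, ← Complex.exp_add, ← Complex.exp_add]
    ring_nf
  rw [Complex.exp_pi_div_two_mul_I] at hpos hneg
  rw [two_sin]
  linear_combination hneg - hpos

theorem two_cpow_mul_pi_cpow (s : ℂ) :
    (2 : ℂ) ^ s * (Real.pi : ℂ) ^ (s - 1) = 2 * (2 * Real.pi : ℂ) ^ (s - 1) := by
  rw [← ofReal_ofNat, mul_cpow_ofReal_nonneg zero_le_two Real.pi_pos.le, ← mul_assoc,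
    cpow_sub (x := (2 : ℝ)) s 1 (by simp), cpow_one, mul_div_cancel₀ _ (by simp)]

theorem riemannAux_eq_of_re_lt {s : ℂ} (hs : s.re < -1) :
    riemannAux s = chiFactor s * (riemannZeta (1 - s) - dualAux s) := by
  have hpow : (2 * Real.pi * dirSE : ℂ) ^ (s - 1) = (2 * Real.pi) ^ (s - 1) * dirSE ^ (s - 1) := by
    refine mul_cpow_of_arg_add_arg_mem ?_ _
    rw [← ofReal_ofNat, ← ofReal_mul, arg_ofReal_of_nonneg Real.two_pi_pos.le, zero_add]
    exact arg_mem_Ioc dirSE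
  rw [riemannAux_eq_mellin hs, mellin_gaussian_div_expDiff (by rw [sub_re, one_re]; linarith),
    neg_sub, sub_sub_cancel, chiFactor, two_cpow_mul_pi_cpow, hpow]
  linear_combination (2 * Real.pi : ℂ) ^ (s - 1) * Gamma (1 - s) *
    (dualAux s - riemannZeta (1 - s)) * dirSW_mul_cpow_sub_mul_dirSE_cpow s

/-! ### Analytic continuation of the functional equation -/

theorem isBigO_log_cobounded : log =O[cobounded ℂ] id := by
  refine .of_bound (1 + Real.pi) ?_
  filter_upwards [tendsto_norm_cobounded_atTop.eventually_ge_atTop 1] with x hx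
  have hre : |(log x).re| ≤ ‖x‖ := by
    rw [log_re, abs_of_nonneg (Real.log_nonneg hx)]
    exact Real.log_le_self (norm_nonneg x)
  have him : |(log x).im| ≤ Real.pi := (log_im x).symm ▸ abs_arg_le_pi x
  have hpi : Real.pi ≤ Real.pi * ‖x‖ := le_mul_of_one_le_right Real.pi_pos.le hx
  rw [id, add_mul, one_mul]
  linarith [norm_le_abs_re_add_abs_im (log x)]

theorem re_sub_im_eq_of_mem_strip_dirSW_half {x : ℂ} (hx : x ∈ strip dirSW (1 / 2) (1 / 2)) :
    x.re - x.im = 1 / 2 := by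
  have := mem_strip_dirSW_iff.1 hx
  exact le_antisymm (by simpa using this.2) (by simpa using this.1)

theorem mem_slitPlane_of_mem_strip_dirSW_half {x : ℂ} (hx : x ∈ strip dirSW (1 / 2) (1 / 2)) :
    x ∈ slitPlane :=
  mem_slitPlane_of_re_sub_im_pos (by rw [re_sub_im_eq_of_mem_strip_dirSW_half hx]; norm_num)

theorem expDiff_ne_zero_of_mem_strip_dirSW_half {x : ℂ} (hx : x ∈ strip dirSW (1 / 2) (1 / 2)) :
    expDiff x ≠ 0 := by
  intro h
  obtain ⟨n, rfl⟩ := expDiff_eq_zero_iff.1 h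
  have h2 := re_sub_im_eq_of_mem_strip_dirSW_half hx
  rw [intCast_re, intCast_im, sub_zero, eq_div_iff two_ne_zero] at h2
  have : n * 2 = 1 := by exact_mod_cast h2
  omega

theorem continuousOn_auxIntegrand_half (s : ℂ) :
    ContinuousOn (auxIntegrand s) (strip dirSW (1 / 2) (1 / 2)) := by
  intro x hx
  have hcpow : ContinuousAt (fun x => x ^ (-s)) x :=
    continuousAt_cpow_const (mem_slitPlane_of_mem_strip_dirSW_half hx)
  exact ((hcpow.mul (by fun_prop)).div differentiable_expDiff.continuous.continuousAt
    (expDiff_ne_zero_of_mem_strip_dirSW_half hx)).continuousWithinAt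

theorem integrable_lineIntegrand_auxIntegrand (s : ℂ) :
    Integrable (lineIntegrand (auxIntegrand s) (1 / 2) dirSW) :=
  (superexpDecayOn_auxIntegrand s _ _).integrable_lineIntegrand dirSW_ne_zero
    (continuousOn_auxIntegrand_half s)

theorem continuousOn_log_slitPlane : ContinuousOn log slitPlane :=
  fun _ hx => (continuousAt_clog hx).continuousWithinAt

theorem differentiable_riemannAux : Differentiable ℂ riemannAux := by
  have hlog : ContinuousOn (fun x => -log x) (strip dirSW (1 / 2) (1 / 2)) :=
    (continuousOn_log_slitPlane.mono fun _ => mem_slitPlane_of_mem_strip_dirSW_half).neg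
  have h := (superexpDecayOn_auxIntegrand 0 (1 / 2) (1 / 2)).differentiable_lineIntegral
    dirSW_ne_zero (continuousOn_auxIntegrand_half 0) hlog
    (isBigO_log_cobounded.mono inf_le_left).neg_left
  refine (funext fun s => lineIntegral_congr fun x hx => ?_ : riemannAux = _) ▸ h
  have hx0 := slitPlane_ne_zero (mem_slitPlane_of_mem_strip_dirSW_half hx)
  rw [auxIntegrand, auxIntegrand, neg_zero, cpow_zero, one_mul, cpow_def_of_ne_zero hx0, mul_comm s,
    neg_mul_comm, mul_div_assoc]

theorem mem_slitPlane_of_re_add_im_pos {x : ℂ} (hx : 0 < x.re + x.im) : x ∈ slitPlane := by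
  rw [mem_slitPlane_iff]
  by_contra! h
  linarith

theorem re_add_im_pos_of_mem_stripSE {m k : ℤ} (hm : 0 ≤ m) {x : ℂ} (hx : x ∈ stripSE m k) :
    0 < x.re + x.im := by
  have : (0 : ℝ) ≤ m := by exact_mod_cast hm
  linarith [(mem_stripSE_iff.1 hx).1]

theorem superexpDecayOn_cpow_mul_quadExp (w : ℂ) (m k : ℤ) :
    SuperexpDecayOn (fun x => x ^ w * quadExp 1 0 x) (stripSE m k) :=
  (superexpDecayOn_quadExp one_pos 0 _ _).mul (expGrowthOn_cpow_const w _)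

theorem differentiableOn_cpow_mul_quadExp (w : ℂ) {m : ℤ} (hm : 0 ≤ m) (k : ℤ) :
    DifferentiableOn ℂ (fun x => x ^ w * quadExp 1 0 x) (stripSE m k) := by
  intro x hx
  have hcpow : DifferentiableAt ℂ (fun x => x ^ w) x := differentiableAt_id.cpow_const
    (mem_slitPlane_of_re_add_im_pos (re_add_im_pos_of_mem_stripSE hm hx))
  exact (hcpow.mul (differentiable_quadExp 1 0 x)).differentiableWithinAt

theorem differentiable_dualAux : Differentiable ℂ dualAux := by
  have hslit {x : ℂ} (hx : x ∈ stripSE 0 0) : x ∈ slitPlane :=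
    mem_slitPlane_of_re_add_im_pos (re_add_im_pos_of_mem_stripSE le_rfl hx)
  have h := ((superexpDecayOn_cpow_mul_quadExp (-1) 0 0).div_expDiff
    dirSE_im_ne_zero).differentiable_lineIntegral dirSE_ne_zero
    ((differentiableOn_cpow_mul_quadExp (-1) le_rfl 0).continuousOn.div
      differentiable_expDiff.continuous.continuousOn fun _ => expDiff_ne_zero_of_mem_stripSE)
    (continuousOn_log_slitPlane.mono fun _ => hslit) (isBigO_log_cobounded.mono inf_le_left)
  refine (funext fun s => lineIntegral_congr fun x hx => ?_ : dualAux = _) ▸ h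
  have hx0 := slitPlane_ne_zero (hslit hx)
  have hcpow : x ^ (s - 1) = exp (s * log x) * x ^ (-1 : ℂ) := by
    rw [mul_comm s, ← cpow_def_of_ne_zero hx0, ← cpow_add _ _ hx0, sub_eq_add_neg]
  simp only [hcpow, mul_assoc, mul_div_assoc]

theorem one_sub_ne_neg_natCast {s : ℂ} (hs : 1 - s ∈ slitPlane) (n : ℕ) : 1 - s ≠ -n := by
  intro h
  rw [h, ← ofReal_natCast, ← ofReal_neg, ofReal_mem_slitPlane] at hs
  linarith [n.cast_nonneg (α := ℝ)]

theorem riemannZeta_eq_chiFactor_mul {s : ℂ} (hs : 1 - s ∈ slitPlane) (h0 : s ≠ 0) :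
    riemannZeta s = chiFactor s * riemannZeta (1 - s) := by
  have h := riemannZeta_one_sub (one_sub_ne_neg_natCast hs) (by simpa using h0)
  rw [sub_sub_cancel, neg_sub, show Real.pi * (1 - s) / 2 = Real.pi / 2 - Real.pi * s / 2 by ring,
    Complex.cos_pi_div_two_sub] at h
  rw [h, chiFactor, two_cpow_mul_pi_cpow]
  ring

theorem differentiableAt_chiFactor {s : ℂ} (hs : 1 - s ∈ slitPlane) :
    DifferentiableAt ℂ chiFactor s := by
  have hGamma : DifferentiableAt ℂ (fun s : ℂ => Gamma (1 - s)) s :=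
    (differentiableAt_Gamma (1 - s) (one_sub_ne_neg_natCast hs)).comp s (by fun_prop)
  have htwo : DifferentiableAt ℂ (fun s : ℂ => (2 : ℂ) ^ s) s :=
    differentiableAt_id.const_cpow (.inl two_ne_zero)
  have hpi : DifferentiableAt ℂ (fun s : ℂ => (Real.pi : ℂ) ^ (s - 1)) s :=
    (differentiableAt_id.sub_const 1).const_cpow (.inl (ofReal_ne_zero.2 Real.pi_ne_zero))
  exact ((htwo.mul hpi).mul (by fun_prop)).mul hGamma

theorem differentiableAt_riemannZeta_of_one_sub_mem_slitPlane {s : ℂ} (hs : 1 - s ∈ slitPlane) :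
    DifferentiableAt ℂ riemannZeta s := by
  refine differentiableAt_riemannZeta fun h => ?_
  rw [h, sub_self] at hs
  exact zero_notMem_slitPlane hs

theorem isOpen_one_sub_mem_slitPlane : IsOpen {s : ℂ | 1 - s ∈ slitPlane} :=
  isOpen_slitPlane.preimage (by fun_prop)

theorem isPreconnected_one_sub_mem_slitPlane : IsPreconnected {s : ℂ | 1 - s ∈ slitPlane} := by
  have hconn : IsPreconnected slitPlane :=
    (starConvex_one_slitPlane.isPathConnected one_mem_slitPlane).isConnected.isPreconnected
  exact (Homeomorph.subLeft (1 : ℂ)).isPreconnected_preimage.2 hconn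

theorem riemannAux_eq_riemannZeta_sub {s : ℂ} (hs : 1 - s ∈ slitPlane) :
    riemannAux s = riemannZeta s - chiFactor s * dualAux s := by
  have hleft : AnalyticOnNhd ℂ riemannAux {s : ℂ | 1 - s ∈ slitPlane} :=
    differentiable_riemannAux.differentiableOn.analyticOnNhd isOpen_one_sub_mem_slitPlane
  have hright : AnalyticOnNhd ℂ (fun s => riemannZeta s - chiFactor s * dualAux s)
      {s : ℂ | 1 - s ∈ slitPlane} :=
    DifferentiableOn.analyticOnNhd (fun z hz =>
      ((differentiableAt_riemannZeta_of_one_sub_mem_slitPlane hz).sub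
        ((differentiableAt_chiFactor hz).mul
          (differentiable_dualAux z))).differentiableWithinAt) isOpen_one_sub_mem_slitPlane
  have hbase : (1 : ℂ) - (-2) ∈ slitPlane := .inl (by norm_num)
  refine hleft.eqOn_of_preconnected_of_eventuallyEq hright isPreconnected_one_sub_mem_slitPlane
    hbase ?_ hs
  filter_upwards [(isOpen_lt continuous_re continuous_const).mem_nhds
    (by norm_num : (-2 : ℂ).re < -1)] with z hz
  have hz1 : z.re < -1 := hz
  have hz0 : z ≠ 0 := by rintro rfl; norm_num at hz1
  have hslit : 1 - z ∈ slitPlane := .inl (by rw [sub_re, one_re]; linarith)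
  rw [riemannAux_eq_of_re_lt hz1, riemannZeta_eq_chiFactor_mul hslit hz0, mul_sub]

/-! ### The expansion around the saddle point -/

theorem log_div_of_re_add_im_pos {x y : ℂ} (hx : 0 < x.re + x.im) (hy : 0 < y.re + y.im) :
    log (x / y) = log x - log y := by
  obtain ⟨hx0, hx1, hx2⟩ := re_add_im_pos_iff.1 hx
  obtain ⟨hy0, hy1, hy2⟩ := re_add_im_pos_iff.1 hy
  have him : (log x - log y).im = arg x - arg y := by rw [sub_im, log_im, log_im]
  rw [← log_exp (x := log x - log y) (by rw [him]; linarith) (by rw [him]; linarith),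
    Complex.exp_sub, exp_log hx0, exp_log hy0]

theorem cpow_mul_quadExp_eq {s η x : ℂ} (hη : η ^ 2 = (s - 1) / (2 * Real.pi * I))
    (hpos : 0 < η.re + η.im) (hx : 0 < x.re + x.im) :
    x ^ (s - 1) * quadExp 1 0 x = η ^ (s - 1) * exp (-(Real.pi * I * η ^ 2)) *
      (exp (-(2 * Real.pi * I * (x - η) ^ 2)) * (wFun η (x - η) + 1)) := by
  have hx0 := (re_add_im_pos_iff.1 hx).1
  have hη0 := (re_add_im_pos_iff.1 hpos).1
  have hs : s - 1 = 2 * Real.pi * I * η ^ 2 := by rw [hη, mul_div_cancel₀ _ two_pi_I_ne_zero]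
  have hquot : 1 + (x - η) / η = x / η := by field_simp; ring
  rw [wFun, sub_add_cancel, quadExp, hquot, log_div_of_re_add_im_pos hx hpos,
    cpow_def_of_ne_zero hx0, cpow_def_of_ne_zero hη0, hs, ← Complex.exp_add, ← Complex.exp_add,
    ← Complex.exp_add, ← Complex.exp_add, ofReal_one]
  congr 1
  field_simp
  ring

theorem gaussian_eq_quadExp (η x : ℂ) : exp (-(2 * Real.pi * I * (x - η) ^ 2)) =
    exp (-(2 * Real.pi * I * η ^ 2)) * quadExp 2 (2 * η) x := by
  rw [quadExp, ← Complex.exp_add, ofReal_ofNat]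
  ring_nf

theorem superexpDecayOn_exp_neg_sub_sq (η a b : ℂ) :
    SuperexpDecayOn (fun x => exp (-(2 * Real.pi * I * (x - η) ^ 2))) (strip dirSE a b) := by
  simpa only [gaussian_eq_quadExp] using
    (superexpDecayOn_quadExp two_pos (2 * η) a b).mul (expGrowthOn_const _ _)

theorem quadExp_one_zero_intCast (n : ℤ) : quadExp 1 0 n = (-1) ^ n := by
  have hexp : quadExp 1 0 n = (exp ((n ^ 2 : ℤ) * (Real.pi * I)))⁻¹ := by
    rw [quadExp, ← Complex.exp_neg]
    push_cast
    ring_nf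
  rw [hexp, Complex.exp_int_mul, exp_pi_mul_I, ← inv_zpow, inv_neg_one]
  rcases n.even_or_odd with h | h
  · rw [h.neg_one_zpow, (h.pow_of_ne_zero two_ne_zero).neg_one_zpow]
  · rw [h.neg_one_zpow, h.pow.neg_one_zpow]

theorem dualAux_eq_sum_add_kernelIntegral (s : ℂ) {k : ℤ} (hk : 0 ≤ k) :
    dualAux s = ∑ n ∈ Finset.Icc 1 k, (n : ℂ) ^ (s - 1) +
      kernelIntegral (fun x => x ^ (s - 1) * quadExp 1 0 x) k := by
  rw [dualAux, kernelIntegral_eq_add_sum hk (differentiableOn_cpow_mul_quadExp _ le_rfl k)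
    (superexpDecayOn_cpow_mul_quadExp _ _ _), zero_add, add_comm]
  refine congrArg (· + _) (Finset.sum_congr rfl fun n _ => ?_)
  have hsign : ((-1 : ℂ) ^ n) * (-1) ^ n = 1 := by rw [← mul_zpow]; simp
  rw [quadExp_one_zero_intCast]
  linear_combination (n : ℂ) ^ (s - 1) * hsign

theorem cpow_mul_exp_ne_zero {s η : ℂ} (hη : η ≠ 0) :
    η ^ (s - 1) * exp (-(Real.pi * I * η ^ 2)) ≠ 0 :=
  mul_ne_zero (by simp [cpow_eq_zero_iff, hη]) (exp_ne_zero _)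

section Remainder

variable {s η : ℂ} (hη : η ^ 2 = (s - 1) / (2 * Real.pi * I)) (hpos : 0 < η.re + η.im) {m : ℤ}
  (hm : 0 ≤ m)

include hη hpos hm

theorem eqOn_remIntegrand : Set.EqOn (remIntegrand η)
    (fun x => ((η ^ (s - 1) * exp (-(Real.pi * I * η ^ 2)))⁻¹ * (x ^ (s - 1) * quadExp 1 0 x) -
      exp (-(2 * Real.pi * I * (x - η) ^ 2))) / expDiff x) (stripSE m m) := by
  intro x hx
  have hC := cpow_mul_exp_ne_zero (s := s) (re_add_im_pos_iff.1 hpos).1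
  simp only [cpow_mul_quadExp_eq hη hpos (re_add_im_pos_of_mem_stripSE hm hx),
    inv_mul_cancel_left₀ hC]
  rw [remIntegrand, expDiff]
  ring

theorem integrable_remIntegrand :
    Integrable (lineIntegrand (remIntegrand η) (m + 1 / 2) dirSE) := by
  rw [lineIntegrand_congr (eqOn_remIntegrand hη hpos hm)]
  exact integrable_lineIntegrand_div_expDiff
    (((differentiableOn_cpow_mul_quadExp _ hm m).continuousOn.const_mul _).sub (by fun_prop))
    (((superexpDecayOn_cpow_mul_quadExp _ m m).mul (expGrowthOn_const _ _)).sub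
      (superexpDecayOn_exp_neg_sub_sq _ _ _))

theorem mul_remainderR_eq : η ^ (s - 1) * exp (-(Real.pi * I * η ^ 2)) * remainderR η m =
    kernelIntegral (fun x => x ^ (s - 1) * quadExp 1 0 x) m -
      η ^ (s - 1) * exp (-(Real.pi * I * η ^ 2)) *
        kernelIntegral (fun x => exp (-(2 * Real.pi * I * (x - η) ^ 2))) m := by
  have hC := cpow_mul_exp_ne_zero (s := s) (re_add_im_pos_iff.1 hpos).1
  have hR : remainderR η m = _ := lineIntegral_congr (eqOn_remIntegrand hη hpos hm)
  rw [hR, ← kernelIntegral, kernelIntegral_sub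
    ((differentiableOn_cpow_mul_quadExp _ hm m).continuousOn.const_mul _)
    ((superexpDecayOn_cpow_mul_quadExp _ m m).mul (expGrowthOn_const _ _)) (by fun_prop)
    (superexpDecayOn_exp_neg_sub_sq _ _ _), kernelIntegral_const_mul, mul_sub,
    mul_inv_cancel_left₀ hC]

theorem siegelPart_eq_dualAux {k : ℤ} (hk : m ≤ k) : siegelPart s η m k = dualAux s := by
  set C := η ^ (s - 1) * exp (-(Real.pi * I * η ^ 2)) with hC
  have hdual := kernelIntegral_eq_add_sum hk (differentiableOn_cpow_mul_quadExp (s - 1) hm k)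
    (superexpDecayOn_cpow_mul_quadExp _ _ _)
  have hgauss := kernelIntegral_eq_add_sum hk
    (by fun_prop : DifferentiableOn ℂ (fun x => exp (-(2 * Real.pi * I * (x - η) ^ 2))) _)
    (superexpDecayOn_exp_neg_sub_sq _ _ _)
  have hsum : ∑ j ∈ Finset.Icc (m + 1) k, (-1) ^ j * ((j : ℂ) ^ (s - 1) * quadExp 1 0 j) =
      C * ∑ j ∈ Finset.Icc (m + 1) k, (-1) ^ j * exp (-(2 * Real.pi * I * (j - η) ^ 2)) -
        C * ∑ j ∈ Finset.Icc (m + 1) k,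
          (-1) ^ (j - 1) * exp (-(2 * Real.pi * I * (j - η) ^ 2)) * wFun η (j - η) := by
    rw [← mul_sub, ← Finset.sum_sub_distrib, Finset.mul_sum]
    refine Finset.sum_congr rfl fun j hj => ?_
    have hj0 : (0 : ℝ) < j := by exact_mod_cast (by rw [Finset.mem_Icc] at hj; omega : 0 < j)
    rw [cpow_mul_quadExp_eq hη hpos (by simpa using hj0), zpow_sub_one₀ (by simp), inv_neg_one]
    ring
  rw [dualAux_eq_sum_add_kernelIntegral s (hm.trans hk), siegelPart, riemannTerm_eq_kernelIntegral,
    ← hC]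
  linear_combination mul_remainderR_eq hη hpos hm + hdual - C * hgauss + hsum

end Remainder

theorem re_add_im_pos_of_sq_eq {s η : ℂ} (hs : s.im ≠ 0 ∨ s.re < 1)
    (hη : η ^ 2 = (s - 1) / (2 * Real.pi * I)) (hη1 : -(Real.pi / 4) < arg η)
    (hη2 : arg η < 3 * Real.pi / 4) : 0 < η.re + η.im := by
  refine re_add_im_pos_iff.2 ⟨?_, hη1, hη2⟩
  rintro rfl
  have hs1 : s = 1 := by
    rw [zero_pow two_ne_zero, eq_comm, div_eq_zero_iff] at hη
    exact sub_eq_zero.1 (hη.resolve_right two_pi_I_ne_zero)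
  simp [hs1] at hs

theorem one_sub_mem_slitPlane_of_sq_eq {s η : ℂ} (hη : η ^ 2 = (s - 1) / (2 * Real.pi * I))
    (hpos : 0 < η.re + η.im) : 1 - s ∈ slitPlane := by
  have hs : 1 - s = (2 * Real.pi : ℝ) * (-I * η ^ 2) := by
    rw [hη]
    push_cast
    field_simp [two_pi_I_ne_zero]
    ring
  have hre : (1 - s).re = 2 * Real.pi * (2 * η.re * η.im) := by
    rw [hs, re_ofReal_mul, neg_mul, neg_re, I_mul_re, sq, mul_im]; ring
  have him : (1 - s).im = 2 * Real.pi * ((η.im - η.re) * (η.re + η.im)) := by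
    rw [hs, im_ofReal_mul, neg_mul, neg_im, I_mul_im, sq, mul_re]; ring
  rw [mem_slitPlane_iff, or_iff_not_imp_right, not_ne_iff, hre, him]
  intro h
  have heq : η.im = η.re := by
    simpa [Real.pi_ne_zero, hpos.ne', sub_eq_zero] using h
  have : 0 < η.re := by linarith
  rw [heq]
  positivity

theorem tendsto_chiFactor_mul_riemannZeta_one_sub_sub (c : ℂ) :
    Tendsto (fun z => chiFactor z * (riemannZeta (1 - z) - c)) (𝓝[≠] 0)
      (𝓝 (riemannZeta 0 - chiFactor 0 * c)) := by
  have hslit : (1 : ℂ) - 0 ∈ slitPlane := by simp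
  have hcont : ContinuousAt (fun z => riemannZeta z - chiFactor z * c) 0 :=
    (differentiableAt_riemannZeta_of_one_sub_mem_slitPlane hslit).continuousAt.sub
      ((differentiableAt_chiFactor hslit).continuousAt.mul_const c)
  refine (hcont.tendsto.mono_left nhdsWithin_le_nhds).congr' ?_
  filter_upwards [mem_nhdsWithin_of_mem_nhds (isOpen_one_sub_mem_slitPlane.mem_nhds hslit),
    self_mem_nhdsWithin] with z hz hz0
  rw [riemannZeta_eq_chiFactor_mul hz hz0, mul_sub]

theorem mainTheorem7_general {s η : ℂ} (hη : η ^ 2 = (s - 1) / (2 * Real.pi * I))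
    (hpos : 0 < η.re + η.im) {m k : ℤ} (hm : 0 ≤ m) (hk : m ≤ k) :
    Integrable (lineIntegrand (auxIntegrand s) (1 / 2) dirSW) ∧
    Integrable (lineIntegrand (remIntegrand η) (m + 1 / 2) dirSE) ∧
    Tendsto (riemannQuot k) (𝓝[≠] η) (𝓝 (riemannTerm k η)) ∧
    (s ≠ 0 → riemannAux s = chiFactor s * (riemannZeta (1 - s) - siegelPart s η m k)) ∧
    (s = 0 → Tendsto (fun z => chiFactor z * (riemannZeta (1 - z) - siegelPart s η m k))
      (𝓝[≠] s) (𝓝 (riemannAux s))) := by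
  have hs := one_sub_mem_slitPlane_of_sq_eq hη hpos
  rw [siegelPart_eq_dualAux hη hpos hm hk, riemannAux_eq_riemannZeta_sub hs]
  refine ⟨integrable_lineIntegrand_auxIntegrand s, integrable_remIntegrand hη hpos hm, ?_, ?_, ?_⟩
  · rw [riemannTerm_eq_kernelIntegral]
    exact tendsto_riemannQuot k η
  · intro h0
    rw [riemannZeta_eq_chiFactor_mul hs h0, mul_sub]
  · rintro rfl
    exact tendsto_chiFactor_mul_riemannZeta_one_sub_sub _

end

/- The hypothesis `hs` says `0 < arg (s - 1) < 2π`, that is, `s` is not in `[1, ∞)`. -/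
theorem mainTheorem7 (s η : ℂ) (hs : s.im ≠ 0 ∨ s.re < 1)
    (hη : η ^ 2 = (s - 1) / (2 * Real.pi * Complex.I))
    (hη1 : -(Real.pi / 4) < arg η) (hη2 : arg η < 3 * Real.pi / 4)
    (m k : ℤ) (hm : m = ⌊η.re + η.im⌋) (hk : m ≤ k) :
    Integrable (lineIntegrand (auxIntegrand s) (1 / 2) dirSW) ∧
    Integrable (lineIntegrand (remIntegrand η) (m + 1 / 2) dirSE) ∧
    Tendsto (riemannQuot k) (𝓝[≠] η) (𝓝 (riemannTerm k η)) ∧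
    (s ≠ 0 → riemannAux s = chiFactor s * (riemannZeta (1 - s) - siegelPart s η m k)) ∧
    (s = 0 → Tendsto (fun z => chiFactor z * (riemannZeta (1 - z) - siegelPart s η m k))
      (𝓝[≠] s) (𝓝 (riemannAux s))) := by
  have hpos := re_add_im_pos_of_sq_eq hs hη hη1 hη2
  exact mainTheorem7_general hη hpos (hm ▸ Int.floor_nonneg.2 hpos.le) hk
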